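/- Let $\mathcal A$ and $\mathcal B$ be abelian categories and $\mathbf F:\mathcal A\to\mathcal B$ an additive, right exact functor. Let $(\mathbf F,\mathcal B)$ be the left comma category: its objects are triples $\binom{Y}{X}_\phi$ with $Y\in\mathcal A$, $X\in\mathcal B$ and $\phi:\mathbf FY\to X$, and its morphisms are the pairs $(\alpha,\beta)$ with $\beta\phi=\phi'\,\mathbf F\alpha$; it is abelian. For an abelian category $\mathcal C$, a complete projective resolution is an exact complex $\cdots\to Q^{-1}\to Q^{0}\to Q^{1}\to\cdots$ of projective objects which remains exact under $\operatorname{Hom}(-,P)$ for every projective $P$. An object is Gorenstein projective if it is isomorphic to $\operatorname{Im}(Q^{-1}\to Q^{0})$ for such a complex; $\mathcal{GP}(\mathcal C)$ is the full subcategory of these objects, and $\underline{\mathcal{GP}(\mathcal C)}$ is its quotient by the morphisms that factor through a projective object of $\mathcal C$. The category $\underline{\mathcal{GP}(\mathcal C)}$ is triangulated as the stable category of the Frobenius category $\mathcal{GP}(\mathcal C)$: the shift $X[1]$ is given by the cokernel $\Sigma X$ in a short exact sequence $0\to X\to P(X)\to \Sigma X\to 0$ with $P(X)$ projective and $\Sigma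 X$ Gorenstein projective, and the distinguished triangles are those isomorphic to $X\xrightarrow{u}Y\to C_u\to \Sigma X$, where $C_u$ is the pushout of $u$ and $X\to P(X)$, and $C_u\to\Sigma X$ is induced by $0:Y\to\Sigma X$ and $P(X)\to\Sigma X$. Assume that $\mathbf F$ is perfect, that is: (P1) if $Q^\bullet$ is an exact complex (indexed by $\mathbb Z$) of projective objects of $\mathcal A$, then $\mathbf FQ^\bullet$ is exact; (P2) if $P^\bullet$ is a complete projective resolution in $\mathcal B$, then $\operatorname{Hom}(P^\bullet,\mathbf FQ)$ is exact for every projective object $Q$ of $\mathcal A$. Then the functors $$\textstyle \binom{Y}{X}_\phi\mapsto\operatorname{Coker}\phi,\qquad X\mapsto\binom{0}{X},\qquad Y\mapsto\binom{Y}{\mathbf FY}_{\mathrm{id}},\qquad \binom{Y}{X}_\phi\mapsto Y$$ preserve Gorenstein projective objects and projective objects, and the functors $$i^*:\underline{\mathcal{GP}((\mathbf F,\mathcal B))}\to\underline{\mathcal{GP}(\mathcal B)},\quad i_*:\underline{\mathcal{GP}(\mathcal B)}\to\underline{\mathcal{GP}((\mathbf F,\mathcal B))},\quad j_!:\underline{\mathcal{GP}(\mathcal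 A)}\to\underline{\mathcal{GP}((\mathbf F,\mathcal B))},\quad j^*:\underline{\mathcal{GP}((\mathbf F,\mathcal B))}\to\underline{\mathcal{GP}(\mathcal A)}$$ that they induce (in this order) form a left recollement of $\underline{\mathcal{GP}((\mathbf F,\mathcal B))}$ relative to $\underline{\mathcal{GP}(\mathcal B)}$ and $\underline{\mathcal{GP}(\mathcal A)}$: all four are exact functors of triangulated categories; $(i^*,i_*)$ and $(j_!,j^*)$ are adjoint pairs; $i_*$ and $j_!$ are fully faithful; $j^*i_*=0$; and for every object $M$ of $\underline{\mathcal{GP}((\mathbf F,\mathcal B))}$ the counit and the unit of these adjunctions fit into a distinguished triangle $$j_!j^*M\to M\to i_*i^*M\to (j_!j^*M)[1].$$ -/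

import Mathlib

open CategoryTheory CategoryTheory.Limits CategoryTheory.Pretriangulated
open scoped ZeroObject

universe v v₁ v₂ v₃ u u₁ u₂ u₃

noncomputable section

namespace GorensteinComma

/-! ### Gorenstein projective objects -/

section Gorenstein

variable {C : Type u} [Category.{v} C] [Abelian C]

/-- The complex of abelian groups `Hom(K, Z)` is exact: every `f : Kʲ ⟶ Z` whose composite with
`Kʲ⁻¹ ⟶ Kʲ` vanishes is the composite of `Kʲ ⟶ Kʲ⁺¹` and some `g : Kʲ⁺¹ ⟶ Z`. -/
def HomExact (K : CochainComplex C ℤ) (Z : C) : Prop :=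
  ∀ (i j k : ℤ), i + 1 = j → j + 1 = k → ∀ f : K.X j ⟶ Z, K.d i j ≫ f = 0 →
    ∃ g : K.X k ⟶ Z, K.d j k ≫ g = f

/-- Complete projective resolutions: exact complexes of projective objects, indexed by `ℤ`,
that remain exact under `Hom(-, P)` for every projective object `P`. -/
structure IsCompleteResolution (K : CochainComplex C ℤ) : Prop where
  projective : ∀ n, Projective (K.X n)
  acyclic : K.Acyclic
  homExact : ∀ P : C, Projective P → HomExact K P

variable (C) in
/-- Gorenstein projective objects: the images of the differential `K⁻¹ ⟶ K⁰` of complete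
projective resolutions `K`. -/
def GProj : ObjectProperty C := fun G =>
  ∃ K : CochainComplex C ℤ, IsCompleteResolution K ∧ Nonempty (G ≅ image (K.d (-1) 0))

variable (C) in
/-- The full subcategory of Gorenstein projective objects. -/
abbrev GP : Type _ := (GProj C).FullSubcategory

variable (C) in
/-- Two morphisms are identified in the stable category when their difference factors through a
projective object. -/
def stableRel : HomRel (GP C) := fun X Y f g =>
  ∃ (P : C) (a : X.obj ⟶ P) (b : P ⟶ Y.obj), Projective P ∧ f.hom - g.hom = a ≫ b

instance : Congruence (stableRel C) where
  comp_left := by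
    rintro X Y Z f g g' ⟨P, a, b, hP, h⟩
    exact ⟨P, f.hom ≫ a, b, hP, by simp [← Preadditive.comp_sub, h]⟩
  comp_right := by
    rintro X Y Z f f' g ⟨P, a, b, hP, h⟩
    exact ⟨P, a, b ≫ g.hom, hP, by simp [← Preadditive.sub_comp, h]⟩
  equivalence := by
    refine ⟨fun f => ?_, ?_, ?_⟩
    · exact ⟨0, 0, 0, inferInstance, by simp⟩
    · rintro f g ⟨P, a, b, hP, h⟩
      exact ⟨P, -a, b, hP, by simp [← h]⟩
    · rintro f g k ⟨P, a, b, hP, h⟩ ⟨P', a', b', hP', h'⟩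
      refine ⟨P ⊞ P', biprod.lift a a', biprod.desc b b', inferInstance, ?_⟩
      simp [← h, ← h']

lemma stableRel_add ⦃X Y : GP C⦄ (f₁ f₂ g₁ g₂ : X ⟶ Y) (hf : stableRel C f₁ f₂)
    (hg : stableRel C g₁ g₂) : stableRel C (f₁ + g₁) (f₂ + g₂) := by
  obtain ⟨P, a, b, hP, h⟩ := hf
  obtain ⟨P', a', b', hP', h'⟩ := hg
  refine ⟨P ⊞ P', biprod.lift a a', biprod.desc b b', inferInstance, ?_⟩
  simp only [biprod.lift_desc, ← h, ← h']
  change (f₁.hom + g₁.hom) - (f₂.hom + g₂.hom) = _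
  abel

variable (C) in
/-- The stable category of Gorenstein projective objects modulo projective objects. -/
abbrev StableGP : Type _ := CategoryTheory.Quotient (stableRel C)

variable (C) in
/-- The projection to the stable category. -/
abbrev toStable : GP C ⥤ StableGP C := CategoryTheory.Quotient.functor (stableRel C)

instance : Preadditive (StableGP C) := CategoryTheory.Quotient.preadditive _ stableRel_add

instance : (toStable C).Additive := CategoryTheory.Quotient.functor_additive _ stableRel_add

lemma gproj_zero : GProj C (0 : C) := by
  refine ⟨0, ⟨fun n => ?_, fun n => ?_, fun P _ i n k _ _ f _ => ⟨0, ?_⟩⟩, ⟨?_⟩⟩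
  · have : IsZero ((0 : CochainComplex C ℤ).X n) :=
      (HomologicalComplex.eval C (ComplexShape.up ℤ) n).map_isZero (isZero_zero _)
    exact Projective.of_iso this.isoZero.symm inferInstance
  · exact ShortComplex.exact_of_isZero_X₂ _
      ((HomologicalComplex.eval C (ComplexShape.up ℤ) n).map_isZero (isZero_zero _))
  · exact IsZero.eq_of_src
      ((HomologicalComplex.eval C (ComplexShape.up ℤ) n).map_isZero (isZero_zero _)) _ _
  · refine (IsZero.iso (isZero_zero C) ?_)
    rw [IsZero.iff_id_eq_zero, ← cancel_epi (factorThruImage _)]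
    exact IsZero.eq_of_src
      ((HomologicalComplex.eval C (ComplexShape.up ℤ) (-1)).map_isZero (isZero_zero _)) _ _

instance : HasZeroObject (StableGP C) where
  zero := by
    refine ⟨(toStable C).obj ⟨0, gproj_zero⟩, ?_⟩
    have : IsZero (⟨0, gproj_zero⟩ : GP C) := by
      rw [IsZero.iff_id_eq_zero]
      ext
    exact (toStable C).map_isZero this

/-! ### The suspension and the standard triangles -/

/-- A short exact sequence `0 ⟶ G ⟶ P ⟶ G' ⟶ 0` with `P` projective and `G'` Gorenstein
projective, such that every morphism from `G` to a projective object extends to `P` (so that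
`G ⟶ P` is an inflation into a projective-injective object of the Frobenius category of Gorenstein
projective objects). -/
structure Cosyzygy (G : GP C) where
  P : C
  obj : GP C
  ι : G.obj ⟶ P
  π : P ⟶ obj.obj
  zero : ι ≫ π = 0
  shortExact : (ShortComplex.mk ι π zero).ShortExact
  projective : Projective P
  extend : ∀ (Q : C), Projective Q → ∀ f : G.obj ⟶ Q, ∃ g : P ⟶ Q, ι ≫ g = f

lemma shortExact_image (S : ShortComplex C) (hS : S.Exact) :
    ∃ h : image.ι S.f ≫ factorThruImage S.g = 0,
      (ShortComplex.mk (image.ι S.f) (factorThruImage S.g) h).ShortExact := by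
  have h : image.ι S.f ≫ factorThruImage S.g = 0 := by
    rw [← cancel_epi (factorThruImage S.f), ← cancel_mono (image.ι S.g)]
    simp
  refine ⟨h, ?_⟩
  have : Mono (ShortComplex.mk (image.ι S.f) (factorThruImage S.g) h).f :=
    inferInstanceAs (Mono (image.ι S.f))
  have : Epi (ShortComplex.mk (image.ι S.f) (factorThruImage S.g) h).g :=
    inferInstanceAs (Epi (factorThruImage S.g))
  let φ : S ⟶ ShortComplex.mk (image.ι S.f) S.g (by
      rw [← cancel_epi (factorThruImage S.f)]; simp) :=
    { τ₁ := factorThruImage S.f, τ₂ := 𝟙 _, τ₃ := 𝟙 _ }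
  let ψ : ShortComplex.mk (image.ι S.f) (factorThruImage S.g) h ⟶
      ShortComplex.mk (image.ι S.f) S.g (by
      rw [← cancel_epi (factorThruImage S.f)]; simp) :=
    { τ₁ := 𝟙 _, τ₂ := 𝟙 _, τ₃ := image.ι S.g }
  have hφ₁ : Epi φ.τ₁ := inferInstanceAs (Epi (factorThruImage S.f))
  have hφ₂ : IsIso φ.τ₂ := inferInstanceAs (IsIso (𝟙 _))
  have hφ₃ : Mono φ.τ₃ := inferInstanceAs (Mono (𝟙 _))
  have hψ₁ : Epi ψ.τ₁ := inferInstanceAs (Epi (𝟙 _))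
  have hψ₂ : IsIso ψ.τ₂ := inferInstanceAs (IsIso (𝟙 _))
  have hψ₃ : Mono ψ.τ₃ := inferInstanceAs (Mono (image.ι S.g))
  refine ShortComplex.ShortExact.mk ?_
  rw [ShortComplex.exact_iff_of_epi_of_isIso_of_mono ψ,
    ← ShortComplex.exact_iff_of_epi_of_isIso_of_mono φ]
  exact hS

lemma shift_isCompleteResolution {K : CochainComplex C ℤ} (hK : IsCompleteResolution K) :
    IsCompleteResolution (K⟦(1 : ℤ)⟧) where
  projective n := hK.projective (n + 1)
  acyclic n := ShortComplex.exact_of_iso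
    ((CochainComplex.shiftShortComplexFunctorIso C 1 n (1 + n) rfl).symm.app K) (hK.acyclic _)
  homExact P hP i j k hij hjk f hf := by
    obtain ⟨g, hg⟩ := hK.homExact P hP (i + 1) (j + 1) (k + 1) (by lia) (by lia) f (by
      have h : (Int.negOnePow 1 • K.d (i + 1) (j + 1)) ≫ f = 0 := hf
      rw [Int.negOnePow_one, Units.neg_smul, one_smul] at h
      exact neg_eq_zero.1 ((Preadditive.neg_comp (K.d (i + 1) (j + 1)) _).symm.trans h))
    refine ⟨-g, ?_⟩
    change (Int.negOnePow 1 • K.d (j + 1) (k + 1)) ≫ (-g) = f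
    simpa using hg

lemma exists_cosyzygy (G : GP C) : Nonempty (Cosyzygy G) := by
  obtain ⟨K, hK, ⟨e⟩⟩ := G.property
  have hS : (K.sc' (-1) 0 1).Exact :=
    (K.exactAt_iff' (-1) 0 1 (by simp) (by simp)).1 (hK.acyclic 0)
  obtain ⟨h, hE⟩ := shortExact_image _ hS
  have hd : (K⟦(1 : ℤ)⟧).d (-1) 0 = -K.d 0 1 := by
    change Int.negOnePow 1 • K.d 0 1 = _
    simp
  have hG' : GProj C (image (K.d 0 1)) :=
    have : StrongEpi (factorThruImage (K.d 0 1)) := strongEpi_of_epi _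
    have e' : image (K.d 0 1) ≅ image (-K.d 0 1) :=
      image.isoStrongEpiMono (factorThruImage (K.d 0 1)) (-image.ι (K.d 0 1)) (by simp)
    ⟨_, shift_isCompleteResolution hK, 
      ⟨e' ≪≫ eqToIso (congrArg (fun f : K.X 0 ⟶ K.X 1 => image f) hd.symm)⟩⟩
  have hz : (e.hom ≫ image.ι (K.d (-1) 0)) ≫ factorThruImage (K.d 0 1) = 0 := by
    rw [Category.assoc]
    exact (congrArg (e.hom ≫ ·) h).trans comp_zero
  refine ⟨⟨K.X 0, ⟨_, hG'⟩, e.hom ≫ image.ι (K.d (-1) 0), factorThruImage (K.d 0 1), hz, ?_,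
    hK.projective 0, fun Q hQ f => ?_⟩⟩
  · let S₁ : ShortComplex C := ShortComplex.mk (image.ι (K.d (-1) 0)) (factorThruImage (K.d 0 1)) h
    let S₂ : ShortComplex C := ShortComplex.mk _ _ hz
    let i : S₁ ≅ S₂ := ShortComplex.isoMk e.symm (Iso.refl _) (Iso.refl _)
      (by simp [S₁, S₂]) (by simp [S₁, S₂])
    exact ShortComplex.shortExact_of_iso i hE
  · obtain ⟨g, hg⟩ := hK.homExact Q hQ (-2) (-1) 0 (by lia) (by lia)
      (factorThruImage (K.d (-1) 0) ≫ e.inv ≫ f) (by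
        have : K.d (-2) (-1) ≫ factorThruImage (K.d (-1) 0) = 0 := by
          rw [← cancel_mono (image.ι _)]
          simp
        rw [reassoc_of% this, zero_comp])
    refine ⟨g, ?_⟩
    have : image.ι (K.d (-1) 0) ≫ g = e.inv ≫ f := by
      rw [← cancel_epi (factorThruImage (K.d (-1) 0))]
      simpa using hg
    simp [this]

/-- A choice of a cosyzygy sequence `0 ⟶ G ⟶ P(G) ⟶ Σ G ⟶ 0`. -/
def cosyzygy (G : GP C) : Cosyzygy G := (exists_cosyzygy G).some

/-- `h : Σ X ⟶ Σ Y` is induced by `f : X ⟶ Y` if it is part of a morphism between the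
chosen cosyzygy sequences that starts with `f`. -/
def IsSuspensionOf {X Y : GP C} (f : X ⟶ Y) (h : (cosyzygy X).obj ⟶ (cosyzygy Y).obj) : Prop :=
  ∃ g : (cosyzygy X).P ⟶ (cosyzygy Y).P,
    (cosyzygy X).ι ≫ g = f.hom ≫ (cosyzygy Y).ι ∧ (cosyzygy X).π ≫ h.hom = g ≫ (cosyzygy Y).π

lemma exists_desc {X : GP C} {Z : C} (t : (cosyzygy X).P ⟶ Z) (ht : (cosyzygy X).ι ≫ t = 0) :
    ∃ s : (cosyzygy X).obj.obj ⟶ Z, (cosyzygy X).π ≫ s = t := by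
  have := (cosyzygy X).shortExact.epi_g
  exact ⟨(cosyzygy X).shortExact.exact.desc t ht, (cosyzygy X).shortExact.exact.g_desc t ht⟩

lemma exists_suspension {X Y : GP C} (f : X ⟶ Y) : ∃ h, IsSuspensionOf f h := by
  obtain ⟨g, hg⟩ := (cosyzygy X).extend _ (cosyzygy Y).projective (f.hom ≫ (cosyzygy Y).ι)
  obtain ⟨s, hs⟩ := exists_desc (g ≫ (cosyzygy Y).π) (by
    rw [← Category.assoc, hg, Category.assoc, (cosyzygy Y).zero, comp_zero])
  exact ⟨ObjectProperty.homMk s, g, hg, hs⟩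

lemma suspension_unique {X Y : GP C} {f f' : X ⟶ Y} {h h' : (cosyzygy X).obj ⟶ (cosyzygy Y).obj}
    (hf : stableRel C f f') (hh : IsSuspensionOf f h) (hh' : IsSuspensionOf f' h') :
    stableRel C h h' := by
  obtain ⟨g, hg, hg₂⟩ := hh
  obtain ⟨g', hg', hg₂'⟩ := hh'
  obtain ⟨Q, a, b, hQ, hab⟩ := hf
  obtain ⟨a', ha'⟩ := (cosyzygy X).extend Q hQ a
  obtain ⟨s, hs⟩ := exists_desc (g - g' - a' ≫ b ≫ (cosyzygy Y).ι) (by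
    rw [Preadditive.comp_sub, Preadditive.comp_sub, hg, hg', reassoc_of% ha',
      ← Preadditive.sub_comp, hab, Category.assoc, sub_self])
  refine ⟨_, s, (cosyzygy Y).π, (cosyzygy Y).projective, ?_⟩
  have := (cosyzygy X).shortExact.epi_g
  have h0 := (cosyzygy Y).zero
  change Epi (cosyzygy X).π at this
  rw [← cancel_epi (cosyzygy X).π, ← Category.assoc, hs, Preadditive.comp_sub, hg₂, hg₂']
  simp [h0]

variable (C) in
/-- The cosyzygy as a functor to the stable category. -/
def suspensionAux : GP C ⥤ StableGP C where
  obj X := (toStable C).obj (cosyzygy X).obj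
  map f := (toStable C).map (exists_suspension f).choose
  map_id X := by
    rw [← (toStable C).map_id]
    exact CategoryTheory.Quotient.sound _ (suspension_unique (Congruence.equivalence.refl (𝟙 X))
      (exists_suspension (𝟙 X)).choose_spec ⟨𝟙 _, by simp, by simp⟩)
  map_comp {X Y Z} f g := by
    rw [← (toStable C).map_comp]
    refine CategoryTheory.Quotient.sound _ (suspension_unique
      (Congruence.equivalence.refl (f ≫ g)) (exists_suspension (f ≫ g)).choose_spec ?_)
    obtain ⟨p, hp, hp'⟩ := (exists_suspension f).choose_spec
    obtain ⟨q, hq, hq'⟩ := (exists_suspension g).choose_spec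
    exact ⟨p ≫ q, by simp [reassoc_of% hp, hq], by simp [reassoc_of% hp', hq']⟩

variable (C) in
/-- The suspension functor `Σ` of the stable category: it sends `X` to the cokernel of the chosen
embedding `X ⟶ P(X)`, and the class of `f` to the class of any `h` induced by `f`. -/
def suspension : StableGP C ⥤ StableGP C :=
  CategoryTheory.Quotient.lift _ (suspensionAux C) (fun _ _ f g hfg =>
    CategoryTheory.Quotient.sound _ (suspension_unique hfg
      (exists_suspension f).choose_spec (exists_suspension g).choose_spec))

variable (C) in
/-- A standard triangle `X ⟶ Y ⟶ Z ⟶ Σ X`: the object `Z` is the pushout of `u : X ⟶ Y` and the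
chosen embedding `X ⟶ P(X)`, and `w : Z ⟶ Σ X` is induced by `0 : Y ⟶ Σ X` and `P(X) ⟶ Σ X`. -/
structure StandardTriangle where
  X : GP C
  Y : GP C
  Z : GP C
  u : X ⟶ Y
  v : Y ⟶ Z
  k : (cosyzygy X).P ⟶ Z.obj
  w : Z ⟶ (cosyzygy X).obj
  isPushout : IsPushout u.hom (cosyzygy X).ι v.hom k
  v_w : v ≫ w = 0
  k_w : k ≫ w.hom = (cosyzygy X).π

/-- The last morphism of a standard triangle, in the stable category. -/
def StandardTriangle.connecting (S : StandardTriangle C) :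
    (toStable C).obj S.Z ⟶ (suspension C).obj ((toStable C).obj S.X) :=
  (toStable C).map S.w

variable (C) in
/-- The triangulated structure of the stable category of the Frobenius category of Gorenstein
projective objects: a triangulated structure on the stable category in which the shift `[1]` is
the suspension `Σ` and in which the distinguished triangles are exactly the triangles isomorphic
to a standard triangle. This determines the triangulated structure up to a canonical isomorphism
that is the identity on the underlying category; the integral shifts `[n]`, `n ≠ 1`, are the only
data that are not prescribed on the nose. -/
class StableTriangulation where
  [shift : HasShift (StableGP C) ℤ]
  [shift_additive : ∀ n : ℤ, (shiftFunctor (StableGP C) n).Additive]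
  [pretriangulated : Pretriangulated (StableGP C)]
  [triangulated : IsTriangulated (StableGP C)]
  shiftIso : shiftFunctor (StableGP C) (1 : ℤ) ≅ suspension C
  distinguished_iff : ∀ T : Triangle (StableGP C), T ∈ distTriang (StableGP C) ↔
    ∃ S : StandardTriangle C, Nonempty (T ≅ Triangle.mk ((toStable C).map S.u)
      ((toStable C).map S.v) (S.connecting ≫ shiftIso.inv.app _))

attribute [reducible, instance] StableTriangulation.shift StableTriangulation.pretriangulated

attribute [instance] StableTriangulation.shift_additive StableTriangulation.triangulated

end Gorenstein

/-! ### Functors induced on stable categories -/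

section Induced

variable {C : Type u₁} [Category.{v₁} C] [Abelian C] {D : Type u₂} [Category.{v₂} D] [Abelian D]

/-- The functor `G` preserves Gorenstein projective objects and projective objects. -/
structure PreservesGP (G : C ⥤ D) : Prop where
  gproj : ∀ X : C, GProj C X → GProj D (G.obj X)
  projective : ∀ P : C, Projective P → Projective (G.obj P)

/-- The functor induced on stable categories by an additive functor which preserves Gorenstein
projective objects and projective objects. -/
def stableMap (G : C ⥤ D) [G.Additive] (hG : PreservesGP G) : StableGP C ⥤ StableGP D :=
  CategoryTheory.Quotient.lift _
    ((GProj D).lift ((GProj C).ι ⋙ G) (fun X => hG.gproj _ X.property) ⋙ toStable D) (by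
      rintro X Y f g ⟨P, a, b, hP, h⟩
      refine CategoryTheory.Quotient.sound _ ⟨G.obj P, G.map a, G.map b, hG.projective P hP, ?_⟩
      rw [← G.map_comp, ← h, G.map_sub]
      rfl)

end Induced

/-! ### Left recollements of triangulated categories -/

/-- Four functors `i^* : T ⥤ T'`, `i_* : T' ⥤ T`, `j_! : T'' ⥤ T`, `j^* : T ⥤ T''` between
triangulated categories form a left recollement of `T` relative to `T'` and `T''`. -/
structure LeftRecollement
    {T' : Type u₁} [Category.{v₁} T'] [HasZeroObject T'] [HasShift T' ℤ] [Preadditive T']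
    [∀ n : ℤ, (shiftFunctor T' n).Additive] [Pretriangulated T'] [IsTriangulated T']
    {T : Type u₂} [Category.{v₂} T] [HasZeroObject T] [HasShift T ℤ] [Preadditive T]
    [∀ n : ℤ, (shiftFunctor T n).Additive] [Pretriangulated T] [IsTriangulated T]
    {T'' : Type u₃} [Category.{v₃} T''] [HasZeroObject T''] [HasShift T'' ℤ] [Preadditive T'']
    [∀ n : ℤ, (shiftFunctor T'' n).Additive] [Pretriangulated T''] [IsTriangulated T'']
    (iUp : T ⥤ T') (iLow : T' ⥤ T) (jShriek : T'' ⥤ T) (jUp : T ⥤ T'') where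
  /-- the four functors are exact functors of triangulated categories -/
  [iUp_commShift : iUp.CommShift ℤ]
  [iUp_exact : iUp.IsTriangulated]
  [iLow_commShift : iLow.CommShift ℤ]
  [iLow_exact : iLow.IsTriangulated]
  [jShriek_commShift : jShriek.CommShift ℤ]
  [jShriek_exact : jShriek.IsTriangulated]
  [jUp_commShift : jUp.CommShift ℤ]
  [jUp_exact : jUp.IsTriangulated]
  /-- the adjoint pairs `(i^*, i_*)` and `(j_!, j^*)` -/
  adj_i : iUp ⊣ iLow
  adj_j : jShriek ⊣ jUp
  /-- `i_*` and `j_!` are fully faithful -/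
  iLow_full : iLow.Full
  iLow_faithful : iLow.Faithful
  jShriek_full : jShriek.Full
  jShriek_faithful : jShriek.Faithful
  /-- `j^* i_* = 0` -/
  comp_zero : ∀ X : T', IsZero (jUp.obj (iLow.obj X))
  /-- the counit and the unit fit into a distinguished triangle
  `j_! j^* X ⟶ X ⟶ i_* i^* X ⟶ (j_! j^* X)[1]` -/
  triangle : ∀ X : T, ∃ h : iLow.obj (iUp.obj X) ⟶ (jShriek.obj (jUp.obj X))⟦(1 : ℤ)⟧,
    Triangle.mk (adj_j.counit.app X) (adj_i.unit.app X) h ∈ distTriang T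

/-! ### The left comma category -/

section LeftComma

variable {A : Type u₁} [Category.{v₁} A] [Abelian A] {B : Type u₂} [Category.{v₂} B] [Abelian B]

/-- The left comma category `(F, B)`: objects are triples `(Y, X, φ : F Y ⟶ X)`. -/
abbrev LeftComma (F : A ⥤ B) : Type _ := Comma F (𝟭 B)

/-- The functor `F` is perfect: it sends exact complexes of projective objects to exact complexes,
and `Hom(P, F Q)` is exact for every complete projective resolution `P` in `B` and every projective
object `Q` of `A`. -/
structure IsPerfect (F : A ⥤ B) [F.Additive] : Prop where
  exact : ∀ Q : CochainComplex A ℤ, (∀ n, Projective (Q.X n)) → Q.Acyclic →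
    ((F.mapHomologicalComplex (ComplexShape.up ℤ)).obj Q).Acyclic
  homExact : ∀ P : CochainComplex B ℤ, IsCompleteResolution P →
    ∀ Q : A, Projective Q → HomExact P (F.obj Q)

variable (F : A ⥤ B) [F.Additive]

section

variable [PreservesFiniteColimits F]

instance (J : Type) [SmallCategory J] [FinCategory J] :
    PreservesLimitsOfShape J (Comma.fst F (𝟭 B)) where
  preservesLimit :=
    preservesLimit_of_preserves_limit_cone
      (Comma.coneOfPreservesIsLimit _ (limit.isLimit _) (limit.isLimit _)) (limit.isLimit _)

instance (J : Type) [SmallCategory J] [FinCategory J] :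
    PreservesLimitsOfShape J (Comma.snd F (𝟭 B)) where
  preservesLimit :=
    preservesLimit_of_preserves_limit_cone
      (Comma.coneOfPreservesIsLimit _ (limit.isLimit _) (limit.isLimit _)) (limit.isLimit _)

instance (X Y : LeftComma F) (f : X ⟶ Y) : IsIso (Abelian.coimageImageComparison f) := by
  have h₁ : IsIso ((Comma.fst F (𝟭 B)).map (Abelian.coimageImageComparison f)) := by
    rw [Arrow.isIso_iff_isIso_of_isIso
      (Abelian.PreservesCoimageImageComparison.iso (Comma.fst F (𝟭 B)) f).hom]
    infer_instance
  have h₂ : IsIso ((Comma.snd F (𝟭 B)).map (Abelian.coimageImageComparison f)) := by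
    rw [Arrow.isIso_iff_isIso_of_isIso
      (Abelian.PreservesCoimageImageComparison.iso (Comma.snd F (𝟭 B)) f).hom]
    infer_instance
  exact (Comma.isoMk (asIso ((Comma.fst F (𝟭 B)).map (Abelian.coimageImageComparison f)))
    (asIso ((Comma.snd F (𝟭 B)).map (Abelian.coimageImageComparison f)))
    (Abelian.coimageImageComparison f).w).isIso_hom

/-- The left comma category of a right exact functor is abelian. -/
instance : Abelian (LeftComma F) := Abelian.ofCoimageImageComparisonIsIso

end

/-- The functor `(Y, X, φ) ↦ Coker φ`. -/
def cokerFunctor : LeftComma F ⥤ B where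
  obj M := cokernel M.hom
  map f := cokernel.map _ _ (F.map f.left) f.right f.w.symm

/-- The functor `X ↦ (0, X)`. -/
def zeroLeft : B ⥤ LeftComma F where
  obj X := { left := 0, right := X, hom := 0 }
  map f := { left := 0, right := f, w := by simp }
  map_id X := by ext; rfl

/-- The functor `Y ↦ (Y, F Y, id)`. -/
def freeFunctor : A ⥤ LeftComma F where
  obj Y := { left := Y, right := F.obj Y, hom := 𝟙 _ }
  map f := { left := f, right := F.map f }

/-- The functor `(Y, X, φ) ↦ Y`. -/
abbrev leftFunctor : LeftComma F ⥤ A := Comma.fst F (𝟭 B)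

instance : (cokerFunctor F).Additive where
  map_add {M N f g} := by
    apply coequalizer.hom_ext
    erw [Preadditive.comp_add]
    simp [cokerFunctor]
    rfl

instance : (zeroLeft F).Additive where
  map_add {X Y f g} := by
    ext
    · exact IsZero.eq_of_src (isZero_zero A) _ _
    · rfl

instance : (freeFunctor F).Additive where
  map_add {X Y f g} := by
    ext
    · rfl
    · exact F.map_add

end LeftComma

end GorensteinComma

end

open GorensteinComma

/-
An object `X` resolved by a complete projective resolution `K` is recovered from the homotopy class
of `K`, so that `X ↦ K` embeds the stable category fully faithfully into the homotopy category of
complexes. Its image is closed under shifts and mapping cones: the shifted complex resolves `Σ X`,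
and the cone of a lift of `u` resolves the pushout `C_u`. Hence the triangulated structure of the
homotopy category restricts to the one of the theorem, and an additive functor that preserves
projective objects and complete projective resolutions induces an exact functor.

Perfectness makes all four functors of this kind: by (P1), (P2) and the adjunctions, the exactness
conditions pass along `0 ⟶ (0, X) ⟶ (Y, X) ⟶ (Y, 0) ⟶ 0` and
`0 ⟶ (Y, F Y) ⟶ (Y, X) ⟶ (0, Coker φ) ⟶ 0`. If `(Y, X)` is Gorenstein projective, then `φ` is a
monomorphism, so that the second sequence is exact; it induces the triangle of the recollement.
-/

noncomputable section

namespace GorensteinComma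

lemma exists_int_section {T : ℤ → Type*} (r : ∀ n, T n → T (n + 1) → Prop)
    (up : ∀ n (x : T n), ∃ y, r n x y) (down : ∀ n (y : T (n + 1)), ∃ x, r n x y) (x₀ : T 0) :
    ∃ s : ∀ n, T n, s 0 = x₀ ∧ ∀ n, r n (s n) (s (n + 1)) := by
  choose a ha using up
  choose b hb using down
  let nonneg : ∀ n : ℕ, T (Int.ofNat n) := fun n => Nat.rec x₀ (fun n x => a (Int.ofNat n) x) n
  let neg : ∀ n : ℕ, T (Int.negSucc n) := fun n =>
    Nat.rec (b (Int.negSucc 0) x₀) (fun n x => b (Int.negSucc (n + 1)) x) n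
  refine ⟨fun n => Int.rec nonneg neg n, rfl, fun n => ?_⟩
  obtain n | (_ | n) := n
  · exact ha (Int.ofNat n) (nonneg n)
  · exact hb (Int.negSucc 0) x₀
  · exact hb (Int.negSucc (n + 1)) (neg n)

section Complexes

variable {C : Type u} [Category.{v} C] [Abelian C] {K L : CochainComplex C ℤ}

lemma exact_of_acyclic (hK : K.Acyclic) {i j k : ℤ} (hij : i + 1 = j) (hjk : j + 1 = k) :
    (ShortComplex.mk (K.d i j) (K.d j k) (K.d_comp_d i j k)).Exact :=
  (K.exactAt_iff' i j k (by simp; lia) (by simp; lia)).1 (hK j)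

lemma exists_lift_of_projective (hK : K.Acyclic) {i j k : ℤ} (hij : i + 1 = j) (hjk : j + 1 = k)
    {Q : C} [Projective Q] (x : Q ⟶ K.X j) (hx : x ≫ K.d j k = 0) :
    ∃ y : Q ⟶ K.X i, y ≫ K.d i j = x :=
  ⟨(exact_of_acyclic hK hij hjk).liftFromProjective x hx,
    (exact_of_acyclic hK hij hjk).liftFromProjective_comp x hx⟩

lemma exists_hom_f_zero_eq (hK : ∀ n, Projective (K.X n)) (hL : L.Acyclic)
    (h : ∀ n, HomExact K (L.X n)) (a₀ : K.X 0 ⟶ L.X 0)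
    (ha₀ : K.d (-1) 0 ≫ a₀ ≫ L.d 0 1 = 0) : ∃ φ : K ⟶ L, φ.f 0 = a₀ := by
  let T (n : ℤ) : Type v := { a : K.X n ⟶ L.X n //
    ∀ m, m + 1 = n → K.d m n ≫ a ≫ L.d n (n + 1) = 0 }
  have up (n : ℤ) (x : T n) : ∃ y : T (n + 1), K.d n (n + 1) ≫ y.1 = x.1 ≫ L.d n (n + 1) := by
    obtain ⟨b, hb⟩ := h (n + 1) (n - 1) n (n + 1) (by lia) rfl _ (x.2 (n - 1) (by lia))
    refine ⟨⟨b, fun m hm => ?_⟩, hb⟩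
    obtain rfl : m = n := by lia
    simp [reassoc_of% hb]
  have down (n : ℤ) (y : T (n + 1)) : ∃ x : T n, K.d n (n + 1) ≫ y.1 = x.1 ≫ L.d n (n + 1) := by
    have := hK n
    obtain ⟨a, ha⟩ := exists_lift_of_projective hL rfl rfl (K.d n (n + 1) ≫ y.1)
      (by rw [Category.assoc, y.2 n rfl])
    exact ⟨⟨a, fun m _ => by simp [ha]⟩, ha.symm⟩
  obtain ⟨x, hx₀, hx⟩ := exists_int_section _ up down ⟨a₀, fun m hm => by
    obtain rfl : m = -1 := by lia
    exact ha₀⟩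
  exact ⟨{ f := fun n => (x n).1, comm' := fun i j hij => by obtain rfl := hij; exact (hx i).symm },
    congrArg Subtype.val hx₀⟩

lemma nonempty_homotopy_zero (hK : ∀ n, Projective (K.X n)) (hL : L.Acyclic)
    (h : ∀ n, HomExact K (L.X n)) (φ : K ⟶ L) (h₀ : K.X 0 ⟶ L.X (-1))
    (w : K.d (-1) 0 ≫ h₀ ≫ L.d (-1) 0 = K.d (-1) 0 ≫ φ.f 0) : Nonempty (Homotopy φ 0) := by
  let T (n : ℤ) : Type v := { a : K.X (n + 1) ⟶ L.X n //
    K.d n (n + 1) ≫ a ≫ L.d n (n + 1) = K.d n (n + 1) ≫ φ.f (n + 1) }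
  let R (n : ℤ) (x : T n) (y : T (n + 1)) : Prop :=
    K.d (n + 1) (n + 1 + 1) ≫ y.1 = φ.f (n + 1) - x.1 ≫ L.d n (n + 1)
  have up (n : ℤ) (x : T n) : ∃ y, R n x y := by
    obtain ⟨b, hb⟩ := h (n + 1) n (n + 1) (n + 1 + 1) rfl rfl
      (φ.f (n + 1) - x.1 ≫ L.d n (n + 1)) (by rw [Preadditive.comp_sub, x.2, sub_self])
    exact ⟨⟨b, by simp [reassoc_of% hb]⟩, hb⟩
  have down (n : ℤ) (y : T (n + 1)) : ∃ x, R n x y := by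
    have := hK (n + 1)
    obtain ⟨a, ha⟩ := exists_lift_of_projective hL rfl rfl
      (φ.f (n + 1) - K.d (n + 1) (n + 1 + 1) ≫ y.1) (by simp [y.2])
    exact ⟨⟨a, by simp [ha]⟩, by simp [R, ha]⟩
  let start : T (-1) := ⟨h₀, w⟩
  obtain ⟨x₀, -⟩ := up (-1) start
  obtain ⟨x, -, hx⟩ := exists_int_section R up down x₀
  let H (i j : ℤ) (hij : (ComplexShape.up ℤ).Rel j i) : K.X i ⟶ L.X j :=
    (K.XIsoOfEq hij.symm).hom ≫ (x j).1
  have hφ : φ = Homotopy.nullHomotopicMap' H := by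
    ext n
    obtain ⟨m, rfl⟩ : ∃ m, m + 1 = n := ⟨n - 1, by lia⟩
    rw [Homotopy.nullHomotopicMap'_f (rfl : m + 1 = m + 1) rfl H]
    have hxm : K.d (m + 1) (m + 1 + 1) ≫ (x (m + 1)).1 = φ.f (m + 1) - (x m).1 ≫ L.d m (m + 1) :=
      hx m
    simp [H, hxm]
  exact ⟨(Homotopy.ofEq hφ).trans (Homotopy.nullHomotopy' H)⟩

end Complexes

section Resolutions

variable {C : Type u} [Category.{v} C] [Abelian C]

/-- A presentation of `X` as the cokernel of the differential `K⁻² ⟶ K⁻¹` of a complete projective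
resolution `K`; by exactness, `X` is then the image of `K⁻¹ ⟶ K⁰`. -/
structure Resolution (X : C) where
  K : CochainComplex C ℤ
  complete : IsCompleteResolution K
  p : K.X (-1) ⟶ X
  epi_p : Epi p
  d_p : K.d (-2) (-1) ≫ p = 0
  exists_desc : ∀ {T : C} (g : K.X (-1) ⟶ T), K.d (-2) (-1) ≫ g = 0 → ∃ g' : X ⟶ T, p ≫ g' = g

namespace Resolution

attribute [instance] epi_p

attribute [simp] d_p

variable {X Y Z : C} (r : Resolution X) (s : Resolution Y) (t : Resolution Z)

@[simp]
lemma d_p_assoc {T : C} (f : X ⟶ T) : r.K.d (-2) (-1) ≫ r.p ≫ f = 0 := by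
  rw [← Category.assoc, d_p, zero_comp]

/-- The object `X` as the cokernel of the differential `K⁻² ⟶ K⁻¹`. -/
def isColimit : IsColimit (CokernelCofork.ofπ r.p r.d_p) :=
  CokernelCofork.IsColimit.ofπ' _ _ fun g hg =>
    ⟨(r.exists_desc g hg).choose, (r.exists_desc g hg).choose_spec⟩

/-- The embedding `X ⟶ K⁰` induced by the differential `K⁻¹ ⟶ K⁰`. -/
def i : X ⟶ r.K.X 0 := (r.exists_desc (r.K.d (-1) 0) (by simp)).choose

@[simp]
lemma p_i : r.p ≫ r.i = r.K.d (-1) 0 := (r.exists_desc (r.K.d (-1) 0) (by simp)).choose_spec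

@[simp]
lemma p_i_assoc {T : C} (f : r.K.X 0 ⟶ T) : r.p ≫ r.i ≫ f = r.K.d (-1) 0 ≫ f := by
  rw [← r.p_i, Category.assoc]

lemma i_eq {j : X ⟶ r.K.X 0} (hj : r.p ≫ j = r.K.d (-1) 0) : r.i = j := by
  rw [← cancel_epi r.p, p_i, hj]

instance : Mono r.i := Preadditive.mono_of_cancel_zero _ fun {T} x hx => by
  obtain ⟨T₁, π₁, _, y, hy⟩ := surjective_up_to_refinements_of_epi r.p x
  have exact := exact_of_acyclic r.complete.acyclic (i := -2) (j := -1) (k := 0) rfl rfl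
  obtain ⟨T₂, π₂, _, z, hz⟩ := exact.exact_up_to_refinements y
    (show y ≫ r.K.d (-1) 0 = 0 by rw [← r.p_i, ← reassoc_of% hy, hx, comp_zero])
  dsimp only at z hz
  rw [← cancel_epi (π₂ ≫ π₁), Category.assoc, hy, reassoc_of% hz, d_p, comp_zero, comp_zero]

lemma i_d : r.i ≫ r.K.d 0 1 = 0 := by
  rw [← cancel_epi r.p, p_i_assoc, HomologicalComplex.d_comp_d, comp_zero]

/-- The resolution given by an image factorization of the differential `K⁻¹ ⟶ K⁰`. -/
def ofFac {K : CochainComplex C ℤ} (hK : IsCompleteResolution K) (p : K.X (-1) ⟶ X)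
    (i : X ⟶ K.X 0) [Epi p] [Mono i] (fac : p ≫ i = K.d (-1) 0) : Resolution X where
  K := K
  complete := hK
  p := p
  epi_p := inferInstance
  d_p := by rw [← cancel_mono i, Category.assoc, fac, zero_comp, K.d_comp_d]
  exists_desc {T} g hg := by
    have hp : K.d (-2) (-1) ≫ p = 0 := by
      rw [← cancel_mono i, Category.assoc, fac, zero_comp, K.d_comp_d]
    let φ : ShortComplex.mk (K.d (-2) (-1)) p hp ⟶
        ShortComplex.mk (K.d (-2) (-1)) (K.d (-1) 0) (K.d_comp_d _ _ _) :=
      { τ₁ := 𝟙 _, τ₂ := 𝟙 _, τ₃ := i }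
    have : Epi φ.τ₁ := inferInstanceAs (Epi (𝟙 _))
    have : IsIso φ.τ₂ := inferInstanceAs (IsIso (𝟙 _))
    have : Mono φ.τ₃ := ‹Mono i›
    have exact : (ShortComplex.mk (K.d (-2) (-1)) p hp).Exact :=
      (ShortComplex.exact_iff_of_epi_of_isIso_of_mono φ).2
        (exact_of_acyclic hK.acyclic rfl rfl)
    exact ⟨exact.desc g hg, exact.g_desc g hg⟩

@[simp]
lemma ofFac_i {K : CochainComplex C ℤ} (hK : IsCompleteResolution K) (p : K.X (-1) ⟶ X)
    (i : X ⟶ K.X 0) [Epi p] [Mono i] (fac : p ≫ i = K.d (-1) 0) : (ofFac hK p i fac).i = i :=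
  i_eq _ fac

lemma gproj (r : Resolution X) : GProj C X :=
  have : StrongEpi r.p := strongEpi_of_epi _
  ⟨r.K, r.complete, ⟨image.isoStrongEpiMono r.p r.i r.p_i⟩⟩

lemma nonempty_of_gproj (hX : GProj C X) : Nonempty (Resolution X) := by
  obtain ⟨K, hK, ⟨e⟩⟩ := hX
  exact ⟨ofFac hK (factorThruImage _ ≫ e.inv) (e.hom ≫ image.ι _) (by simp)⟩

lemma exists_extend {Q : C} (hQ : Projective Q) (a : X ⟶ Q) : ∃ a' : r.K.X 0 ⟶ Q, r.i ≫ a' = a := by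
  obtain ⟨g, hg⟩ := r.complete.homExact Q hQ (-2) (-1) 0 rfl rfl (r.p ≫ a) (by simp)
  exact ⟨g, by rw [← cancel_epi r.p, p_i_assoc, hg]⟩

/-- The morphism of complexes `φ` induces `f` on the resolved objects. -/
def Covers (f : X ⟶ Y) (φ : r.K ⟶ s.K) : Prop := r.p ≫ f = φ.f (-1) ≫ s.p

namespace Covers

variable {r s t} {f : X ⟶ Y} {φ : r.K ⟶ s.K}

lemma i_comp (h : Covers r s f φ) : r.i ≫ φ.f 0 = f ≫ s.i := by
  rw [← cancel_epi r.p, p_i_assoc, reassoc_of% (show r.p ≫ f = _ from h), p_i, φ.comm]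

lemma id : Covers r r (𝟙 X) (𝟙 r.K) := by simp [Covers]

lemma comp (h : Covers r s f φ) {g : Y ⟶ Z} {ψ : s.K ⟶ t.K} (h' : Covers s t g ψ) :
    Covers r t (f ≫ g) (φ ≫ ψ) := by
  dsimp only [Covers] at h h' ⊢
  rw [reassoc_of% h, h', HomologicalComplex.comp_f, Category.assoc]

lemma add (h : Covers r s f φ) {g : X ⟶ Y} {ψ : r.K ⟶ s.K} (h' : Covers r s g ψ) :
    Covers r s (f + g) (φ + ψ) := by
  dsimp only [Covers] at h h' ⊢
  rw [Preadditive.comp_add, h, h', HomologicalComplex.add_f_apply, Preadditive.add_comp]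

lemma sub (h : Covers r s f φ) {g : X ⟶ Y} {ψ : r.K ⟶ s.K} (h' : Covers r s g ψ) :
    Covers r s (f - g) (φ - ψ) := by
  dsimp only [Covers] at h h' ⊢
  rw [Preadditive.comp_sub, h, h', HomologicalComplex.sub_f_apply, Preadditive.sub_comp]

end Covers

lemma exists_covered (φ : r.K ⟶ s.K) : ∃ f : X ⟶ Y, Covers r s f φ :=
  r.exists_desc (φ.f (-1) ≫ s.p) (by rw [← φ.comm_assoc, d_p, comp_zero])

lemma exists_covers (f : X ⟶ Y) : ∃ φ : r.K ⟶ s.K, Covers r s f φ := by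
  obtain ⟨a₀, ha₀⟩ := r.exists_extend (s.complete.projective 0) (f ≫ s.i)
  have hd : r.K.d (-1) 0 ≫ a₀ = r.p ≫ f ≫ s.i := by rw [← p_i_assoc, ha₀]
  obtain ⟨φ, rfl⟩ := exists_hom_f_zero_eq r.complete.projective s.complete.acyclic
    (fun n => r.complete.homExact _ (s.complete.projective n)) a₀ (by
      rw [reassoc_of% hd, i_d, comp_zero, comp_zero])
  refine ⟨φ, ?_⟩
  rw [Covers, ← cancel_mono s.i, Category.assoc, Category.assoc, ← hd, p_i, φ.comm]

lemma Covers.nonempty_homotopy_zero {f : X ⟶ Y} {φ : r.K ⟶ s.K} (h : Covers r s f φ) {Q : C}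
    (hQ : Projective Q) (a : X ⟶ Q) (b : Q ⟶ Y) (hab : f = a ≫ b) :
    Nonempty (Homotopy φ 0) := by
  obtain ⟨a', ha'⟩ := r.exists_extend hQ a
  have hb : Projective.factorThru b s.p ≫ s.p = b := Projective.factorThru_comp b s.p
  refine GorensteinComma.nonempty_homotopy_zero r.complete.projective s.complete.acyclic
    (fun n => r.complete.homExact _ (s.complete.projective n)) φ
    (a' ≫ Projective.factorThru b s.p) ?_
  rw [← p_i_assoc, ← p_i_assoc, h.i_comp, hab, ← s.p_i]
  simp only [Category.assoc, reassoc_of% ha', reassoc_of% hb]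

lemma Covers.exists_fac_of_homotopy {f : X ⟶ Y} {φ : r.K ⟶ s.K} (h : Covers r s f φ)
    (H : Homotopy φ 0) : ∃ (Q : C) (a : X ⟶ Q) (b : Q ⟶ Y), Projective Q ∧ f = a ≫ b := by
  refine ⟨_, r.i, H.hom 0 (-1) ≫ s.p, r.complete.projective 0, ?_⟩
  have hφ : φ.f (-1) = r.K.d (-1) 0 ≫ H.hom 0 (-1) + H.hom (-1) (-2) ≫ s.K.d (-2) (-1) := by
    have := H.comm (-1)
    rwa [dNext_eq _ (show (ComplexShape.up ℤ).Rel (-1) 0 by simp),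
      prevD_eq _ (show (ComplexShape.up ℤ).Rel (-2) (-1) by simp),
      HomologicalComplex.zero_f, add_zero] at this
  rw [← cancel_epi r.p, h, hφ]
  simp

end Resolution

end Resolutions

section Cosyzygies

variable {C : Type u} [Category.{v} C] [Abelian C]

lemma exact_epi_comp_comp_mono {X' X Y Z Z' : C} {f : X ⟶ Y} {g : Y ⟶ Z} {w : f ≫ g = 0}
    (h : (ShortComplex.mk f g w).Exact) (p : X' ⟶ X) [Epi p] (i : Z ⟶ Z') [Mono i]
    (w' : (p ≫ f) ≫ g ≫ i = 0) : (ShortComplex.mk (p ≫ f) (g ≫ i) w').Exact := by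
  rw [ShortComplex.exact_iff_exact_up_to_refinements] at h ⊢
  intro T x hx
  obtain ⟨T₁, π₁, _, y, hy⟩ := h x (by simpa [← cancel_mono i] using hx)
  obtain ⟨T₂, π₂, _, z, hz⟩ := surjective_up_to_refinements_of_epi p y
  exact ⟨T₂, π₂ ≫ π₁, inferInstance, z, by
    dsimp only at hy ⊢; rw [Category.assoc, hy, reassoc_of% hz]⟩

namespace IsCompleteResolution

variable {K : CochainComplex C ℤ}

lemma shift (hK : IsCompleteResolution K) (n : ℤ) : IsCompleteResolution (K⟦n⟧) where
  projective i := hK.projective (i + n)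
  acyclic i := ShortComplex.exact_of_iso
    ((CochainComplex.shiftShortComplexFunctorIso C n i (n + i) rfl).symm.app K) (hK.acyclic _)
  homExact P hP i j k hij hjk f hf := by
    change K.X (j + n) ⟶ P at f
    change (n.negOnePow • K.d (i + n) (j + n)) ≫ f = 0 at hf
    rw [Linear.units_smul_comp, smul_eq_zero_iff_eq] at hf
    obtain ⟨g, hg⟩ := hK.homExact P hP (i + n) (j + n) (k + n) (by lia) (by lia) f hf
    refine ⟨n.negOnePow • g, ?_⟩
    change (n.negOnePow • K.d (j + n) (k + n)) ≫ (n.negOnePow • g) = f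
    rw [Linear.units_smul_comp, Linear.comp_units_smul, smul_smul, Int.units_mul_self, one_smul,
      hg]

lemma gproj_image (hK : IsCompleteResolution K) {i j n : ℤ} (hi : -1 + n = i) (hj : 0 + n = j) :
    GProj C (image (K.d i j)) := by
  subst hi hj
  have mono : Mono (n.negOnePow • image.ι (K.d (-1 + n) (0 + n))) := by
    rcases Int.units_eq_one_or n.negOnePow with h | h <;> rw [h]
    · rw [one_smul]; infer_instance
    · rw [Units.neg_smul, one_smul]; infer_instance
  have fac : factorThruImage (K.d (-1 + n) (0 + n)) ≫ (n.negOnePow • image.ι _) =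
      n.negOnePow • K.d (-1 + n) (0 + n) := by
    rw [Linear.comp_units_smul, image.fac]
  have epi : Epi (factorThruImage (K.d (-1 + n) (0 + n))) := inferInstance
  exact (@Resolution.ofFac _ _ _ _ _ (hK.shift n) _ _ epi mono fac).gproj

lemma exists_extend_image (hK : IsCompleteResolution K) {i j : ℤ} (hij : i + 1 = j) {Q : C}
    (hQ : Projective Q) (f : image (K.d i j) ⟶ Q) :
    ∃ g : K.X j ⟶ Q, image.ι (K.d i j) ≫ g = f := by
  have h : K.d (i - 1) i ≫ factorThruImage (K.d i j) = 0 := by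
    rw [← cancel_mono (image.ι _), Category.assoc, image.fac, K.d_comp_d, zero_comp]
  obtain ⟨g, hg⟩ := hK.homExact Q hQ (i - 1) i j (by lia) hij (factorThruImage (K.d i j) ≫ f)
    (by rw [reassoc_of% h, zero_comp])
  exact ⟨g, by rw [← cancel_epi (factorThruImage (K.d i j)), image.fac_assoc, hg]⟩

end IsCompleteResolution

lemma exists_cosyzygy_iso (Y : GP C) : ∃ (X : GP C) (c : Cosyzygy X), Nonempty (c.obj ≅ Y) := by
  obtain ⟨K, hK, ⟨e⟩⟩ := Y.property
  obtain ⟨zero, shortExact⟩ := shortExact_image _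
    (exact_of_acyclic hK.acyclic (i := -2) (j := -1) (k := 0) rfl rfl)
  exact ⟨⟨image (K.d (-2) (-1)), hK.gproj_image (n := -1) rfl rfl⟩,
    { P := K.X (-1)
      obj := ⟨image (K.d (-1) 0), hK.gproj_image (n := 0) rfl rfl⟩
      ι := image.ι (K.d (-2) (-1))
      π := factorThruImage (K.d (-1) 0)
      zero := zero
      shortExact := shortExact
      projective := hK.projective (-1)
      extend := fun Q hQ f => hK.exists_extend_image rfl hQ f },
    ⟨ObjectProperty.isoMk _ e.symm⟩⟩

/-- A sequence of cosyzygy sequences `0 ⟶ Xₙ ⟶ Pₙ ⟶ Xₙ₊₁ ⟶ 0` indexed by `ℤ`, whose Yoneda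
product is a complete resolution. -/
structure CosyzygySequence (C : Type u) [Category.{v} C] [Abelian C] where
  X : ℤ → GP C
  c : ∀ n, Cosyzygy (X n)
  iso : ∀ n, (c n).obj ≅ X (n + 1)

namespace CosyzygySequence

variable (S : CosyzygySequence C) (n : ℤ)

/-- The epimorphism `Pₙ ⟶ Xₙ₊₁`. -/
def π : (S.c n).P ⟶ (S.X (n + 1)).obj := (S.c n).π ≫ (S.iso n).hom.hom

lemma ι_π : (S.c n).ι ≫ S.π n = 0 := by rw [π, reassoc_of% (S.c n).zero, zero_comp]

lemma shortExact : (ShortComplex.mk _ _ (S.ι_π n)).ShortExact :=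
  ShortComplex.shortExact_of_iso
    (ShortComplex.isoMk (S₁ := ShortComplex.mk _ _ (S.c n).zero) (Iso.refl _) (Iso.refl _)
      ((GProj C).ι.mapIso (S.iso n)) (by simp) (by simp [π])) (S.c n).shortExact

instance : Mono (S.c n).ι := (S.c n).shortExact.mono_f

instance : Epi (S.π n) := (S.shortExact n).epi_g

lemma π_ι_comp : (S.π n ≫ (S.c (n + 1)).ι) ≫ S.π (n + 1) ≫ (S.c (n + 1 + 1)).ι = 0 := by
  rw [Category.assoc, reassoc_of% S.ι_π (n + 1), zero_comp, comp_zero]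

/-- The complex `⋯ ⟶ Pₙ ⟶ Pₙ₊₁ ⟶ ⋯`. -/
abbrev complex : CochainComplex C ℤ :=
  CochainComplex.of (fun n => (S.c n).P) (fun n => S.π n ≫ (S.c (n + 1)).ι) S.π_ι_comp

lemma complex_d : S.complex.d n (n + 1) = S.π n ≫ (S.c (n + 1)).ι :=
  CochainComplex.of_d (fun n => (S.c n).P) (fun n => S.π n ≫ (S.c (n + 1)).ι) n

lemma exact : (ShortComplex.mk _ _ (S.π_ι_comp n)).Exact :=
  exact_epi_comp_comp_mono (S.shortExact (n + 1)).exact _ _ _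

lemma complete : IsCompleteResolution S.complex where
  projective n := (S.c n).projective
  acyclic j := by
    obtain ⟨n, rfl⟩ : ∃ n, n + 1 = j := ⟨j - 1, by lia⟩
    rw [S.complex.exactAt_iff' n (n + 1) (n + 1 + 1) (by simp) (by simp)]
    have exact_of_eq {f : (S.c n).P ⟶ (S.c (n + 1)).P} {g : (S.c (n + 1)).P ⟶ (S.c (n + 1 + 1)).P}
        {w : f ≫ g = 0} (hf : f = S.π n ≫ (S.c (n + 1)).ι)
        (hg : g = S.π (n + 1) ≫ (S.c (n + 1 + 1)).ι) : (ShortComplex.mk f g w).Exact := by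
      subst hf hg
      exact S.exact n
    exact exact_of_eq (S.complex_d n) (S.complex_d (n + 1))
  homExact Q hQ := by
    rintro n _ _ rfl rfl f hf
    rw [complex_d] at hf
    have hf' : (S.c (n + 1)).ι ≫ f = 0 := by
      rw [← cancel_epi (S.π n), comp_zero, ← Category.assoc]; exact hf
    obtain ⟨g, hg⟩ := (S.c (n + 1 + 1)).extend Q hQ ((S.shortExact (n + 1)).exact.desc f hf')
    refine ⟨g, ?_⟩
    rw [complex_d]
    refine (Category.assoc _ _ _).trans ?_
    rw [hg]
    exact (S.shortExact (n + 1)).exact.g_desc f hf'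

lemma exists_of_cosyzygy {X : GP C} (c : Cosyzygy X) : ∃ S : CosyzygySequence C,
    (⟨S.X 0, S.c 0⟩ : Σ X : GP C, Cosyzygy X) = ⟨X, c⟩ := by
  obtain ⟨s, hs₀, hs⟩ := exists_int_section (T := fun _ => Σ X : GP C, Cosyzygy X)
    (fun _ a b => Nonempty (a.2.obj ≅ b.1)) (fun _ a => ⟨⟨a.2.obj, cosyzygy _⟩, ⟨Iso.refl _⟩⟩)
    (fun _ b => (exists_cosyzygy_iso b.1).elim fun X ⟨c, e⟩ => ⟨⟨X, c⟩, e⟩) ⟨X, c⟩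
  exact ⟨⟨fun n => (s n).1, fun n => (s n).2, fun n => (hs n).some⟩, hs₀⟩

end CosyzygySequence

lemma Cosyzygy.exists_resolution {X : GP C} (c : Cosyzygy X) :
    ∃ (r : Resolution X.obj) (e : r.K.X 0 ≅ c.P), r.i ≫ e.hom = c.ι := by
  obtain ⟨S, hS⟩ := CosyzygySequence.exists_of_cosyzygy c
  obtain ⟨rfl, rfl⟩ := hS
  let r : Resolution (S.X 0).obj := Resolution.ofFac S.complete (S.π (-1)) (S.c 0).ι (by
      exact (S.complex_d (-1)).symm)
  exact ⟨r, Iso.refl _, (Category.comp_id _).trans (Resolution.ofFac_i ..)⟩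

end Cosyzygies

section ToHomotopy

variable {C : Type u} [Category.{v} C] [Abelian C]

namespace Resolution

variable {X Y Z : C} (r : Resolution X) (s : Resolution Y) (t : Resolution Z)

/-- The resolution as an object of the homotopy category. -/
abbrev homotopyObj : HomotopyCategory C (ComplexShape.up ℤ) :=
  (HomotopyCategory.quotient _ _).obj r.K

/-- The homotopy class of the morphisms of resolutions that cover `f`. -/
def homotopyMap (f : X ⟶ Y) : r.homotopyObj ⟶ s.homotopyObj :=
  (HomotopyCategory.quotient _ _).map (r.exists_covers s f).choose

variable {r s} in
lemma Covers.quotient_map_eq_iff {f g : X ⟶ Y} {φ ψ : r.K ⟶ s.K} (hφ : Covers r s f φ)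
    (hψ : Covers r s g ψ) :
    (HomotopyCategory.quotient _ _).map φ = (HomotopyCategory.quotient _ _).map ψ ↔
      ∃ (P : C) (a : X ⟶ P) (b : P ⟶ Y), Projective P ∧ f - g = a ≫ b := by
  rw [← sub_eq_zero, ← Functor.map_sub, HomotopyCategory.quotient_map_eq_zero_iff]
  constructor
  · rintro ⟨H⟩
    exact (hφ.sub hψ).exists_fac_of_homotopy r s H
  · rintro ⟨P, a, b, hP, h⟩
    exact (hφ.sub hψ).nonempty_homotopy_zero r s hP a b h

lemma homotopyMap_eq_iff {f g : X ⟶ Y} : homotopyMap r s f = homotopyMap r s g ↔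
    ∃ (P : C) (a : X ⟶ P) (b : P ⟶ Y), Projective P ∧ f - g = a ≫ b :=
  Covers.quotient_map_eq_iff (r.exists_covers s f).choose_spec (r.exists_covers s g).choose_spec

variable {r s} in
lemma Covers.homotopyMap_eq {f : X ⟶ Y} {φ : r.K ⟶ s.K} (h : Covers r s f φ) :
    homotopyMap r s f = (HomotopyCategory.quotient _ _).map φ :=
  ((r.exists_covers s f).choose_spec.quotient_map_eq_iff h).2 ⟨0, 0, 0, inferInstance, by simp⟩

lemma homotopyMap_id : homotopyMap r r (𝟙 X) = 𝟙 _ := by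
  rw [Covers.id.homotopyMap_eq, CategoryTheory.Functor.map_id]

lemma homotopyMap_comp (f : X ⟶ Y) (g : Y ⟶ Z) :
    homotopyMap r t (f ≫ g) = homotopyMap r s f ≫ homotopyMap s t g := by
  obtain ⟨φ, hφ⟩ := r.exists_covers s f
  obtain ⟨ψ, hψ⟩ := s.exists_covers t g
  rw [hφ.homotopyMap_eq, hψ.homotopyMap_eq, (hφ.comp hψ).homotopyMap_eq, Functor.map_comp]

lemma homotopyMap_add (f g : X ⟶ Y) :
    homotopyMap r s (f + g) = homotopyMap r s f + homotopyMap r s g := by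
  obtain ⟨φ, hφ⟩ := r.exists_covers s f
  obtain ⟨ψ, hψ⟩ := r.exists_covers s g
  rw [hφ.homotopyMap_eq, hψ.homotopyMap_eq, (hφ.add hψ).homotopyMap_eq, Functor.map_add]

lemma homotopyMap_surjective : Function.Surjective (homotopyMap r s) := by
  intro α
  obtain ⟨φ, rfl⟩ := (HomotopyCategory.quotient _ _).map_surjective α
  obtain ⟨f, hf⟩ := r.exists_covered s φ
  exact ⟨f, hf.homotopyMap_eq⟩

/-- The homotopy equivalence between resolutions of isomorphic objects. -/
@[simps]
def homotopyIso (e : X ≅ Y) : r.homotopyObj ≅ s.homotopyObj where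
  hom := homotopyMap r s e.hom
  inv := homotopyMap s r e.inv
  hom_inv_id := by rw [← homotopyMap_comp, e.hom_inv_id, homotopyMap_id]
  inv_hom_id := by rw [← homotopyMap_comp, e.inv_hom_id, homotopyMap_id]

end Resolution

/-- A resolution of `X` that extends the chosen cosyzygy sequence. -/
def resolution (X : GP C) : Resolution X.obj := (cosyzygy X).exists_resolution.choose

/-- The identification of the degree zero term of the chosen resolution of `X` with `P(X)`. -/
def resolutionIso (X : GP C) : (resolution X).K.X 0 ≅ (cosyzygy X).P :=
  (cosyzygy X).exists_resolution.choose_spec.choose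

@[simp]
lemma resolution_i_comp (X : GP C) :
    (resolution X).i ≫ (resolutionIso X).hom = (cosyzygy X).ι :=
  (cosyzygy X).exists_resolution.choose_spec.choose_spec

variable (C) in
/-- The embedding of the stable category into the homotopy category by complete resolutions. -/
def toHomotopy : StableGP C ⥤ HomotopyCategory C (ComplexShape.up ℤ) :=
  CategoryTheory.Quotient.lift _
    { obj := fun X => (resolution X).homotopyObj
      map := fun {X Y} f => (resolution X).homotopyMap (resolution Y) f.hom
      map_id := fun X => (resolution X).homotopyMap_id
      map_comp := fun {X Y Z} f g =>
        (resolution X).homotopyMap_comp (resolution Y) (resolution Z) f.hom g.hom }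
    (fun X Y _ _ h => ((resolution X).homotopyMap_eq_iff (resolution Y)).2 h)

lemma toHomotopy_map {X Y : GP C} (f : X ⟶ Y) : (toHomotopy C).map ((toStable C).map f) =
    (resolution X).homotopyMap (resolution Y) f.hom := rfl

instance : (toHomotopy C).Full where
  map_surjective {X Y} α := by
    obtain ⟨f, hf⟩ := (resolution X.as).homotopyMap_surjective (resolution Y.as) α
    exact ⟨(toStable C).map (ObjectProperty.homMk f), hf⟩

instance : (toHomotopy C).Faithful where
  map_injective {X Y} f g h := by
    obtain ⟨f, rfl⟩ := (toStable C).map_surjective f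
    obtain ⟨g, rfl⟩ := (toStable C).map_surjective g
    exact CategoryTheory.Quotient.sound _
      (((resolution X.as).homotopyMap_eq_iff (resolution Y.as)).1 h)

instance : (toHomotopy C).Additive where
  map_add {X Y} f g := by
    obtain ⟨f, rfl⟩ := (toStable C).map_surjective f
    obtain ⟨g, rfl⟩ := (toStable C).map_surjective g
    rw [← Functor.map_add]
    exact (resolution X.as).homotopyMap_add (resolution Y.as) f.hom g.hom

lemma toHomotopy_essImage {X : C} (r : Resolution X) :
    (toHomotopy C).essImage r.homotopyObj :=
  ⟨(toStable C).obj ⟨X, r.gproj⟩, ⟨(resolution _).homotopyIso r (Iso.refl _)⟩⟩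

end ToHomotopy

section Transport

/-- The isomorphism between the triangles on given morphisms that is given by isomorphisms
between their objects. -/
def triangleMkIso {D : Type u₂} [Category.{v₂} D] [HasShift D ℤ] {X₁ X₂ X₃ Y₁ Y₂ Y₃ : D}
    {f : X₁ ⟶ X₂} {g : X₂ ⟶ X₃} {h : X₃ ⟶ X₁⟦(1 : ℤ)⟧} {f' : Y₁ ⟶ Y₂} {g' : Y₂ ⟶ Y₃}
    {h' : Y₃ ⟶ Y₁⟦(1 : ℤ)⟧} (e₁ : X₁ ≅ Y₁) (e₂ : X₂ ≅ Y₂) (e₃ : X₃ ≅ Y₃)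
    (comm₁ : f ≫ e₂.hom = e₁.hom ≫ f') (comm₂ : g ≫ e₃.hom = e₂.hom ≫ g')
    (comm₃ : h ≫ e₁.hom⟦(1 : ℤ)⟧' = e₃.hom ≫ h') : Triangle.mk f g h ≅ Triangle.mk f' g' h' :=
  Triangle.isoMk (Triangle.mk f g h) (Triangle.mk f' g' h') e₁ e₂ e₃ comm₁ comm₂ comm₃

variable {T : Type u₁} [Category.{v₁} T] {D : Type u₂} [Category.{v₂} D] [HasShift D ℤ] (R : T ⥤ D)

section Shift

variable [R.Full] [R.Faithful] (hR : ∀ (X : T) (n : ℤ), R.essImage ((R.obj X)⟦n⟧))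

/-- The shift induced along a fully faithful functor whose essential image is stable under
shifts. -/
@[reducible]
def inducedShift : HasShift T ℤ :=
  (Functor.FullyFaithful.ofFullyFaithful R).hasShift
    (fun n => Functor.essImage.liftFunctor (R ⋙ shiftFunctor D n) R (fun X => hR X n))
    (fun n => Functor.essImage.liftFunctorCompIso (R ⋙ shiftFunctor D n) R (fun X => hR X n))

/-- The compatibility of a fully faithful functor with the shift that it induces. -/
@[reducible]
def inducedShiftCommShift :
    letI := inducedShift R hR
    R.CommShift ℤ :=
  Functor.CommShift.ofHasShiftOfFullyFaithful (Functor.FullyFaithful.ofFullyFaithful R)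
    (fun n => Functor.essImage.liftFunctor (R ⋙ shiftFunctor D n) R (fun X => hR X n))
    (fun n => Functor.essImage.liftFunctorCompIso (R ⋙ shiftFunctor D n) R (fun X => hR X n))

end Shift

variable [HasShift T ℤ] [R.CommShift ℤ] [Preadditive D] [∀ n : ℤ, (shiftFunctor D n).Additive]

lemma shiftFunctor_additive_of_faithful [Preadditive T] [R.Additive] [R.Faithful] (n : ℤ) :
    (shiftFunctor T n).Additive :=
  have : (shiftFunctor T n ⋙ R).Additive := Functor.additive_of_iso (R.commShiftIso n).symm
  Functor.additive_of_comp_faithful _ R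

variable [HasZeroObject D] [Pretriangulated D]

lemma exists_map_distinguished [R.Full] {X Y Z : T} {f : X ⟶ Y} {g : R.obj Y ⟶ R.obj Z}
    {h : R.obj Z ⟶ (R.obj X)⟦(1 : ℤ)⟧} (mem : Triangle.mk (R.map f) g h ∈ distTriang D) :
    ∃ (g' : Y ⟶ Z) (h' : Z ⟶ X⟦(1 : ℤ)⟧),
      R.mapTriangle.obj (Triangle.mk f g' h') ∈ distTriang D :=
  ⟨R.preimage g, R.preimage (h ≫ (R.commShiftIso (1 : ℤ)).inv.app X),
    isomorphic_distinguished _ mem _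
      (triangleMkIso (f := R.map f) (g := R.map (R.preimage g))
        (h := R.map (R.preimage _) ≫ (R.commShiftIso (1 : ℤ)).hom.app X)
        (Iso.refl _) (Iso.refl _) (Iso.refl _) (by simp) (by simp) (by simp))⟩

lemma distinguished_of_iso₃ {X Y Z Z' : D} {f : X ⟶ Y} {g : Y ⟶ Z'} {h : Z' ⟶ X⟦(1 : ℤ)⟧}
    (mem : Triangle.mk f g h ∈ distTriang D) (e : Z ≅ Z') :
    Triangle.mk f (g ≫ e.inv) (e.hom ≫ h) ∈ distTriang D :=
  isomorphic_distinguished _ mem _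
    (triangleMkIso (Iso.refl _) (Iso.refl _) e (by simp) (by simp) (by simp))

lemma exists_triangle_hom [R.Full] [R.Faithful] {T₁ T₂ : Triangle T}
    (hT₁ : R.mapTriangle.obj T₁ ∈ distTriang D)
    (hT₂ : R.mapTriangle.obj T₂ ∈ distTriang D) (a : T₁.obj₁ ⟶ T₂.obj₁) (b : T₁.obj₂ ⟶ T₂.obj₂)
    (comm : T₁.mor₁ ≫ b = a ≫ T₂.mor₁) :
    ∃ c : T₁.obj₃ ⟶ T₂.obj₃,
      T₁.mor₂ ≫ c = b ≫ T₂.mor₂ ∧ T₁.mor₃ ≫ a⟦(1 : ℤ)⟧' = c ≫ T₂.mor₃ := by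
  have comm' : R.map T₁.mor₁ ≫ R.map b = R.map a ≫ R.map T₂.mor₁ := by
    simp only [← R.map_comp, comm]
  obtain ⟨c, hc₁, hc₂⟩ :=
    complete_distinguished_triangle_morphism _ _ hT₁ hT₂ (R.map a) (R.map b) comm'
  obtain ⟨c, rfl⟩ := R.map_surjective c
  refine ⟨c, R.map_injective ?_, R.map_injective ?_⟩
  · rw [R.map_comp, R.map_comp]
    exact hc₁
  · rw [← cancel_mono ((R.commShiftIso (1 : ℤ)).hom.app T₂.obj₁)]
    change (R.map T₁.mor₃ ≫ (R.commShiftIso (1 : ℤ)).hom.app T₁.obj₁) ≫ (R.map a)⟦(1 : ℤ)⟧' =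
      R.map c ≫ R.map T₂.mor₃ ≫ (R.commShiftIso (1 : ℤ)).hom.app T₂.obj₁ at hc₂
    simpa [R.commShiftIso_hom_naturality a (1 : ℤ)] using hc₂

variable [Preadditive T] [R.Additive]

lemma map_contractible_distinguished [HasZeroObject T] (X : T) :
    R.mapTriangle.obj (contractibleTriangle X) ∈ distTriang D :=
  isomorphic_distinguished _ (contractible_distinguished (R.obj X)) _
    (triangleMkIso (f := R.map (𝟙 X)) (g := R.map (0 : X ⟶ 0))
      (h := R.map (0 : 0 ⟶ X⟦(1 : ℤ)⟧) ≫ (R.commShiftIso (1 : ℤ)).hom.app X)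
      (Iso.refl _) (Iso.refl _) R.mapZeroObject (by simp) (by simp) (by simp))

variable [R.Full] [R.Faithful] [HasZeroObject T] [∀ n : ℤ, (shiftFunctor T n).Additive]

/-- The pretriangulated structure induced along a fully faithful functor whose essential image
is stable under cones. -/
@[reducible]
def inducedPretriangulated
    (hR : ∀ {X Y : T} (f : X ⟶ Y), ∃ (Z : T) (g : R.obj Y ⟶ R.obj Z)
      (h : R.obj Z ⟶ (R.obj X)⟦(1 : ℤ)⟧), Triangle.mk (R.map f) g h ∈ distTriang D) :
    Pretriangulated T where
  distinguishedTriangles := R.mapTriangle.obj ⁻¹' (distTriang D)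
  isomorphic_distinguished _ hT₁ _ e := isomorphic_distinguished _ hT₁ _ (R.mapTriangle.mapIso e)
  contractible_distinguished X := map_contractible_distinguished R X
  distinguished_cocone_triangle f := by
    obtain ⟨Z, g, h, mem⟩ := hR f
    exact ⟨Z, exists_map_distinguished R mem⟩
  rotate_distinguished_triangle T :=
    (rotate_distinguished_triangle (R.mapTriangle.obj T)).trans
      (distinguished_iff_of_iso (R.mapTriangleRotateIso.app T))
  complete_distinguished_triangle_morphism _ _ hT₁ hT₂ a b comm :=
    exists_triangle_hom R hT₁ hT₂ a b comm

end Transport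

section StableShift

variable {C : Type u} [Category.{v} C] [Abelian C]

open CochainComplex in
lemma HomExact.cone {K L : CochainComplex C ℤ} {P : C} (hK : HomExact K P)
    (hL : HomExact L P) (φ : K ⟶ L) : HomExact (mappingCone φ) P := by
  rintro i _ _ rfl rfl f hf
  obtain ⟨b, hb⟩ := hL i (i + 1) (i + 1 + 1) rfl rfl ((mappingCone.inr φ).f (i + 1) ≫ f) (by
    rw [← (mappingCone.inr φ).comm_assoc, hf, comp_zero])
  have hd : K.d (i + 1) (i + 1 + 1) ≫
      ((mappingCone.inl φ).v (i + 1 + 1) (i + 1) (by lia) ≫ f - φ.f (i + 1 + 1) ≫ b) = 0 := by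
    have h : (mappingCone.inl φ).v (i + 1) i (by lia) ≫ (mappingCone φ).d i (i + 1) ≫ f = 0 := by
      rw [hf, comp_zero]
    rw [mappingCone.inl_v_d_assoc φ (i + 1) i (i + 1 + 1) (by lia) (by lia),
      Preadditive.sub_comp, Category.assoc, Category.assoc, ← hb, φ.comm_assoc,
      ← Preadditive.comp_sub] at h
    rw [← neg_eq_zero, ← Preadditive.comp_neg, neg_sub, h]
  obtain ⟨a, ha⟩ := hK (i + 1) (i + 1 + 1) (i + 1 + 1 + 1) rfl rfl _ hd
  refine ⟨-(mappingCone.fst φ).1.v (i + 1 + 1) (i + 1 + 1 + 1) rfl ≫ a +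
    (mappingCone.snd φ).v (i + 1 + 1) (i + 1 + 1) (by lia) ≫ b, ?_⟩
  rw [mappingCone.ext_from_iff φ (i + 1 + 1) (i + 1) rfl]
  constructor
  · rw [mappingCone.inl_v_d_assoc φ (i + 1 + 1) (i + 1) (i + 1 + 1 + 1) (by lia) (by lia)]
    simp [ha]
  · rw [(mappingCone.inr φ).comm_assoc]
    simp [hb]

open CochainComplex in
lemma IsCompleteResolution.cone {K L : CochainComplex C ℤ} (hK : IsCompleteResolution K)
    (hL : IsCompleteResolution L) (φ : K ⟶ L) : IsCompleteResolution (mappingCone φ) where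
  projective n := by
    have := hK.projective (n + 1)
    have := hL.projective n
    exact Projective.of_iso
      (HomologicalComplex.homotopyCofiber.XIsoBiprod φ n (n + 1) rfl).symm inferInstance
  acyclic := by
    rw [← HomotopyCategory.quotient_obj_mem_subcategoryAcyclic_iff_acyclic]
    exact (HomotopyCategory.subcategoryAcyclic C).ext_of_isTriangulatedClosed₃ _
      (HomotopyCategory.mappingCone_triangleh_distinguished φ)
      ((HomotopyCategory.quotient_obj_mem_subcategoryAcyclic_iff_acyclic K).2 hK.acyclic)
      ((HomotopyCategory.quotient_obj_mem_subcategoryAcyclic_iff_acyclic L).2 hL.acyclic)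
  homExact P hP := (hK.homExact P hP).cone (hL.homExact P hP) φ

lemma toHomotopy_essImage_of_complete {K : CochainComplex C ℤ} (hK : IsCompleteResolution K) :
    (toHomotopy C).essImage ((HomotopyCategory.quotient _ _).obj K) :=
  toHomotopy_essImage
    (Resolution.ofFac hK (factorThruImage (K.d (-1) 0)) (image.ι _) (image.fac _))

/-- The shifted resolution of `X`, as a resolution of the suspension of `X`. The sign in `p` is the
one in the third morphism of a mapping cone triangle. -/
def suspensionResolution (X : GP C) : Resolution (cosyzygy X).obj.obj where
  K := (resolution X).K⟦(1 : ℤ)⟧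
  complete := (resolution X).complete.shift 1
  p := -((resolutionIso X).hom ≫ (cosyzygy X).π)
  epi_p := by
    have : Epi (cosyzygy X).π := (cosyzygy X).shortExact.epi_g
    exact inferInstanceAs (Epi (-((resolutionIso X).hom ≫ (cosyzygy X).π)))
  d_p := by
    have h : (resolution X).K.d (-1) 0 ≫ (resolutionIso X).hom ≫ (cosyzygy X).π = 0 := by
      rw [← Resolution.p_i_assoc, reassoc_of% (resolution_i_comp X), (cosyzygy X).zero, comp_zero]
    change (Int.negOnePow 1 • (resolution X).K.d (-1) 0) ≫
      (-((resolutionIso X).hom ≫ (cosyzygy X).π)) = 0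
    simp [h]
  exists_desc {T} g hg := by
    change (resolution X).K.X 0 ⟶ T at g
    change (Int.negOnePow 1 • (resolution X).K.d (-1) 0) ≫ g = 0 at hg
    obtain ⟨g', h⟩ := exists_desc ((resolutionIso X).inv ≫ g) (by
      rw [← cancel_epi (resolution X).p, ← resolution_i_comp, Category.assoc,
        Iso.hom_inv_id_assoc, Resolution.p_i_assoc, comp_zero]
      simpa using hg)
    refine ⟨-g', ?_⟩
    change (-((resolutionIso X).hom ≫ (cosyzygy X).π)) ≫ (-g') = g
    simp [h]

lemma homotopyMap_suspension {X Y : GP C} {f : X ⟶ Y}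
    {h : (cosyzygy X).obj ⟶ (cosyzygy Y).obj} (hf : IsSuspensionOf f h)
    {φ : (resolution X).K ⟶ (resolution Y).K}
    (hφ : (resolution X).Covers (resolution Y) f.hom φ) :
    (suspensionResolution X).homotopyMap (suspensionResolution Y) h.hom =
      (HomotopyCategory.quotient _ _).map (φ⟦(1 : ℤ)⟧') := by
  obtain ⟨g, hg⟩ := (suspensionResolution X).exists_covered (suspensionResolution Y) (φ⟦(1 : ℤ)⟧')
  have hg' : (-((resolutionIso X).hom ≫ (cosyzygy X).π)) ≫ g =
    φ.f 0 ≫ (-((resolutionIso Y).hom ≫ (cosyzygy Y).π)) := hg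
  have hφg : IsSuspensionOf f (ObjectProperty.homMk g) := by
    refine ⟨(resolutionIso X).inv ≫ φ.f 0 ≫ (resolutionIso Y).hom, ?_, ?_⟩
    · simp [← resolution_i_comp, reassoc_of% hφ.i_comp]
    · rw [← cancel_epi (resolutionIso X).hom]
      simpa using hg'
  exact ((Resolution.homotopyMap_eq_iff _ _).2
    (suspension_unique (Congruence.equivalence.refl f) hf hφg)).trans hg.homotopyMap_eq

/-- The shift of the resolution of `X`, computed in complexes or in the homotopy category. -/
def suspensionResolutionIso (X : GP C) :
    (resolution X).homotopyObj⟦(1 : ℤ)⟧ ≅ (suspensionResolution X).homotopyObj :=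
  ((HomotopyCategory.quotient C (ComplexShape.up ℤ)).commShiftIso (1 : ℤ)).symm.app
    (resolution X).K

lemma suspensionResolutionIso_naturality {X Y : GP C} {f : X ⟶ Y}
    {h : (cosyzygy X).obj ⟶ (cosyzygy Y).obj} (hf : IsSuspensionOf f h) :
    ((resolution X).homotopyMap (resolution Y) f.hom)⟦(1 : ℤ)⟧' ≫
        (suspensionResolutionIso Y).hom =
      (suspensionResolutionIso X).hom ≫
        (suspensionResolution X).homotopyMap (suspensionResolution Y) h.hom := by
  obtain ⟨φ, hφ⟩ := (resolution X).exists_covers (resolution Y) f.hom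
  rw [hφ.homotopyMap_eq, homotopyMap_suspension hf hφ]
  exact ((HomotopyCategory.quotient C (ComplexShape.up ℤ)).commShiftIso (1 : ℤ)).inv.naturality φ

/-- The shift of the resolution of `X` is homotopy equivalent to the resolution of the suspension
of `X`. -/
def suspensionHomotopyIso (X : GP C) :
    (resolution X).homotopyObj⟦(1 : ℤ)⟧ ≅ (resolution (cosyzygy X).obj).homotopyObj :=
  suspensionResolutionIso X ≪≫ (suspensionResolution X).homotopyIso (resolution _) (Iso.refl _)

lemma suspensionHomotopyIso_naturality {X Y : GP C} {f : X ⟶ Y}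
    {h : (cosyzygy X).obj ⟶ (cosyzygy Y).obj} (hf : IsSuspensionOf f h) :
    ((resolution X).homotopyMap (resolution Y) f.hom)⟦(1 : ℤ)⟧' ≫ (suspensionHomotopyIso Y).hom =
      (suspensionHomotopyIso X).hom ≫ (resolution _).homotopyMap (resolution _) h.hom := by
  simp only [suspensionHomotopyIso, Iso.trans_hom, Resolution.homotopyIso_hom, Iso.refl_hom,
    reassoc_of% (suspensionResolutionIso_naturality hf), Category.assoc,
    ← Resolution.homotopyMap_comp, Category.id_comp, Category.comp_id]

variable (C) in
/-- The embedding into the homotopy category carries the suspension to the shift. -/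
def toHomotopySuspensionIso :
    toHomotopy C ⋙ shiftFunctor _ (1 : ℤ) ≅ suspension C ⋙ toHomotopy C :=
  NatIso.ofComponents (fun X => suspensionHomotopyIso X.as) (fun {X Y} f => by
    obtain ⟨f, rfl⟩ := (toStable C).map_surjective f
    exact suspensionHomotopyIso_naturality (exists_suspension f).choose_spec)

lemma toHomotopy_essImage_shift (X : StableGP C) (n : ℤ) :
    (toHomotopy C).essImage (((toHomotopy C).obj X)⟦n⟧) :=
  (toHomotopy_essImage_of_complete ((resolution X.as).complete.shift n)).ofIso
    (((HomotopyCategory.quotient C (ComplexShape.up ℤ)).commShiftIso n).app (resolution X.as).K)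

lemma exists_toHomotopy_distinguished {X Y : StableGP C} (f : X ⟶ Y) :
    ∃ (Z : StableGP C) (g : (toHomotopy C).obj Y ⟶ (toHomotopy C).obj Z)
      (h : (toHomotopy C).obj Z ⟶ ((toHomotopy C).obj X)⟦(1 : ℤ)⟧),
      Triangle.mk ((toHomotopy C).map f) g h ∈ distTriang _ := by
  obtain ⟨f, rfl⟩ := (toStable C).map_surjective f
  obtain ⟨φ, hφ⟩ := (resolution X.as).exists_covers (resolution Y.as) f.hom
  obtain ⟨Z, ⟨e⟩⟩ := toHomotopy_essImage_of_complete
    ((resolution X.as).complete.cone (resolution Y.as).complete φ)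
  rw [toHomotopy_map, hφ.homotopyMap_eq]
  exact ⟨Z, _, _,
    distinguished_of_iso₃ (HomotopyCategory.mappingCone_triangleh_distinguished φ) e⟩

variable (C) in
/-- The shift of the stable category. -/
@[reducible]
def stableShift : HasShift (StableGP C) ℤ :=
  inducedShift (toHomotopy C) toHomotopy_essImage_shift

attribute [local instance] stableShift

instance toHomotopyCommShift : (toHomotopy C).CommShift ℤ :=
  inducedShiftCommShift (toHomotopy C) toHomotopy_essImage_shift

variable (C) in
lemma stableShift_additive (n : ℤ) : (shiftFunctor (StableGP C) n).Additive :=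
  shiftFunctor_additive_of_faithful (toHomotopy C) n

attribute [local instance] stableShift_additive

variable (C) in
/-- The pretriangulated structure of the stable category. -/
@[reducible]
def stablePretriangulated : Pretriangulated (StableGP C) :=
  inducedPretriangulated (toHomotopy C) exists_toHomotopy_distinguished

attribute [local instance] stablePretriangulated

instance : (toHomotopy C).IsTriangulated where
  map_distinguished _ hT := hT

variable (C) in
lemma stable_isTriangulated : IsTriangulated (StableGP C) :=
  IsTriangulated.of_fully_faithful_triangulated_functor (toHomotopy C)

variable (C) in
/-- The shift of the stable category is the suspension. -/
def stableShiftIso : shiftFunctor (StableGP C) (1 : ℤ) ≅ suspension C :=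
  ((Functor.FullyFaithful.ofFullyFaithful (toHomotopy C)).whiskeringRight _).preimageIso
    ((toHomotopy C).commShiftIso (1 : ℤ) ≪≫ toHomotopySuspensionIso C)

lemma map_stableShiftIso_inv (X : StableGP C) :
    (toHomotopy C).map ((stableShiftIso C).inv.app X) ≫
      ((toHomotopy C).commShiftIso (1 : ℤ)).hom.app X =
        (toHomotopySuspensionIso C).inv.app X := by
  simp [stableShiftIso]

end StableShift

section MappingCone

open CochainComplex

variable {C : Type u} [Category.{v} C] [Abelian C] {X Y Z : C} {r : Resolution X} {s : Resolution Y}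

namespace Resolution

section

variable (φ : r.K ⟶ s.K) (v : Y ⟶ Z) (k : r.K.X 0 ⟶ Z)

/-- The morphism from the mapping cone in degree `-1` that is `k` on `r.K.X 0` and `s.p ≫ v` on
`s.K.X (-1)`. -/
def coneP : (mappingCone φ).X (-1) ⟶ Z :=
  (mappingCone.fst φ).1.v (-1) 0 (by lia) ≫ k + (mappingCone.snd φ).v (-1) (-1) (by lia) ≫ s.p ≫ v

lemma inl_coneP : (mappingCone.inl φ).v 0 (-1) (by lia) ≫ coneP φ v k = k := by simp [coneP]

lemma inr_coneP : (mappingCone.inr φ).f (-1) ≫ coneP φ v k = s.p ≫ v := by simp [coneP]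

end

variable {f : X ⟶ Y} {φ : r.K ⟶ s.K} {v : Y ⟶ Z} {k : r.K.X 0 ⟶ Z}

lemma epi_coneP (h : IsPushout f r.i v k) : Epi (coneP φ v k) :=
  Preadditive.epi_of_cancel_zero _ fun {T} g hg => by
    have hv : s.p ≫ v ≫ g = 0 := by rw [← Category.assoc, ← inr_coneP φ v k, Category.assoc, hg,
      comp_zero]
    have hk : k ≫ g = 0 := by rw [← inl_coneP φ v k, Category.assoc, hg, comp_zero]
    refine h.hom_ext ?_ (by rw [hk, comp_zero])
    rw [← cancel_epi s.p, hv, comp_zero, comp_zero]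

namespace Covers

lemma d_coneP (hφ : Covers r s f φ) (w : f ≫ v = r.i ≫ k) :
    (mappingCone φ).d (-2) (-1) ≫ coneP φ v k = 0 := by
  have hφ' : r.p ≫ f = φ.f (-1) ≫ s.p := hφ
  rw [mappingCone.ext_from_iff φ (-1) (-2) (by lia)]
  constructor
  · rw [mappingCone.inl_v_d_assoc φ (-1) (-2) 0 (by lia) (by lia), Preadditive.sub_comp,
      Category.assoc, Category.assoc, inr_coneP, inl_coneP, ← reassoc_of% hφ', w, p_i_assoc,
      sub_self, comp_zero]
  · rw [(mappingCone.inr φ).comm_assoc, inr_coneP, d_p_assoc, comp_zero]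

lemma exists_coneP_comp_eq (hφ : Covers r s f φ) (h : IsPushout f r.i v k) {T : C}
    (g : (mappingCone φ).X (-1) ⟶ T) (hg : (mappingCone φ).d (-2) (-1) ≫ g = 0) :
    ∃ g' : Z ⟶ T, coneP φ v k ≫ g' = g := by
  have hφ' : r.p ≫ f = φ.f (-1) ≫ s.p := hφ
  obtain ⟨b, hb⟩ := s.exists_desc ((mappingCone.inr φ).f (-1) ≫ g) (by
    rw [← (mappingCone.inr φ).comm_assoc, hg, comp_zero])
  have hinl : φ.f (-1) ≫ (mappingCone.inr φ).f (-1) ≫ g =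
      r.K.d (-1) 0 ≫ (mappingCone.inl φ).v 0 (-1) (by lia) ≫ g := by
    rw [← sub_eq_zero, ← Category.assoc, ← Category.assoc, ← Preadditive.sub_comp,
      ← mappingCone.inl_v_d φ (-1) (-2) 0 (by lia) (by lia), Category.assoc, hg, comp_zero]
  have hw : f ≫ b = r.i ≫ (mappingCone.inl φ).v 0 (-1) (by lia) ≫ g := by
    rw [← cancel_epi r.p, reassoc_of% hφ', hb, hinl, p_i_assoc]
  refine ⟨h.desc b _ hw, (mappingCone.ext_from_iff φ 0 (-1) (by lia) _ _).2 ⟨?_, ?_⟩⟩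
  · rw [← Category.assoc, inl_coneP, h.inr_desc]
  · rw [← Category.assoc, inr_coneP, Category.assoc, h.inl_desc, hb]

/-- The mapping cone of a morphism of resolutions that covers `f`, as a resolution of the pushout
of `f` and `r.i`. -/
def coneResolution (hφ : Covers r s f φ) (h : IsPushout f r.i v k) : Resolution Z where
  K := mappingCone φ
  complete := r.complete.cone s.complete φ
  p := coneP φ v k
  epi_p := epi_coneP h
  d_p := hφ.d_coneP h.w
  exists_desc := hφ.exists_coneP_comp_eq h

lemma covers_inr (hφ : Covers r s f φ) (h : IsPushout f r.i v k) :
    Covers s (hφ.coneResolution h) v (mappingCone.inr φ) :=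
  (inr_coneP φ v k).symm

end Covers

end Resolution

end MappingCone

section StandardTriangles

attribute [local instance] stableShift stableShift_additive stablePretriangulated

variable {C : Type u} [Category.{v} C] [Abelian C]

lemma isPushout_resolution_i {X Y : GP C} {Z : C} {u : X ⟶ Y} {v : Y.obj ⟶ Z}
    {k : (cosyzygy X).P ⟶ Z} (h : IsPushout u.hom (cosyzygy X).ι v k) :
    IsPushout u.hom (resolution X).i v ((resolutionIso X).hom ≫ k) :=
  h.of_iso (Iso.refl _) (Iso.refl _) (resolutionIso X).symm (Iso.refl _) (by simp)
    (by simp [← resolution_i_comp]) (by simp) (by simp)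

lemma covers_triangle_mor₃ {X Y Z : GP C} {u : X ⟶ Y} {v : Y ⟶ Z} {w : Z ⟶ (cosyzygy X).obj}
    {k : (cosyzygy X).P ⟶ Z.obj} {φ : (resolution X).K ⟶ (resolution Y).K}
    (hφ : (resolution X).Covers (resolution Y) u.hom φ)
    (h : IsPushout u.hom (cosyzygy X).ι v.hom k) (hv : v.hom ≫ w.hom = 0)
    (hk : k ≫ w.hom = (cosyzygy X).π) :
    (hφ.coneResolution (isPushout_resolution_i h)).Covers (suspensionResolution X) w.hom
      (CochainComplex.mappingCone.triangle φ).mor₃ := by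
  let m : (CochainComplex.mappingCone φ).X (-1) ⟶ (resolution X).K.X 0 :=
    (CochainComplex.mappingCone.triangle φ).mor₃.f (-1)
  have hm₁ : (CochainComplex.mappingCone.inl φ).v 0 (-1) (by lia) ≫ m = -𝟙 _ :=
    CochainComplex.mappingCone.inl_v_triangle_mor₃_f φ 0 (-1) (by lia)
  have hm₂ : (CochainComplex.mappingCone.inr φ).f (-1) ≫ m = 0 :=
    CochainComplex.mappingCone.inr_f_triangle_mor₃_f φ (-1)
  change Resolution.coneP φ v.hom ((resolutionIso X).hom ≫ k) ≫ w.hom =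
    m ≫ (-((resolutionIso X).hom ≫ (cosyzygy X).π))
  refine (CochainComplex.mappingCone.ext_from_iff φ 0 (-1) (by lia) _ _).2 ⟨?_, ?_⟩
  · rw [← Category.assoc, Resolution.inl_coneP, reassoc_of% hm₁, Category.assoc, hk]
    simp
  · rw [← Category.assoc, Resolution.inr_coneP, reassoc_of% hm₂, Category.assoc, hv, comp_zero,
      zero_comp]

lemma homotopyMap_distinguished (S : StandardTriangle C) :
    Triangle.mk ((resolution S.X).homotopyMap (resolution S.Y) S.u.hom)
      ((resolution S.Y).homotopyMap (resolution S.Z) S.v.hom)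
      ((resolution S.Z).homotopyMap (suspensionResolution S.X) S.w.hom ≫
        (suspensionResolutionIso S.X).inv) ∈ distTriang _ := by
  obtain ⟨φ, hφ⟩ := (resolution S.X).exists_covers (resolution S.Y) S.u.hom
  let t := hφ.coneResolution (isPushout_resolution_i S.isPushout)
  have hv := (hφ.covers_inr (isPushout_resolution_i S.isPushout)).homotopyMap_eq
  have hw := (covers_triangle_mor₃ hφ S.isPushout (congrArg (·.hom) S.v_w) S.k_w).homotopyMap_eq
  have mem : Triangle.mk ((resolution S.X).homotopyMap (resolution S.Y) S.u.hom)
      ((resolution S.Y).homotopyMap t S.v.hom)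
      (t.homotopyMap (suspensionResolution S.X) S.w.hom ≫
        (suspensionResolutionIso S.X).inv) ∈ distTriang _ := by
    rw [hφ.homotopyMap_eq, hv, hw]
    exact HomotopyCategory.mappingCone_triangleh_distinguished φ
  have mem' := distinguished_of_iso₃ mem ((resolution S.Z).homotopyIso t (Iso.refl _))
  simpa only [Resolution.homotopyIso_hom, Resolution.homotopyIso_inv, Iso.refl_hom, Iso.refl_inv,
    ← Category.assoc, ← Resolution.homotopyMap_comp, Category.comp_id, Category.id_comp] using mem'

/-- A standard triangle as a triangle of the stable category. -/
abbrev StandardTriangle.triangle (S : StandardTriangle C) : Triangle (StableGP C) :=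
  Triangle.mk ((toStable C).map S.u) ((toStable C).map S.v)
    (S.connecting ≫ (stableShiftIso C).inv.app _)

lemma map_connecting (S : StandardTriangle C) :
    (toHomotopy C).map (S.connecting ≫ (stableShiftIso C).inv.app ((toStable C).obj S.X)) ≫
      ((toHomotopy C).commShiftIso (1 : ℤ)).hom.app ((toStable C).obj S.X) =
    (resolution S.Z).homotopyMap (suspensionResolution S.X) S.w.hom ≫
      (suspensionResolutionIso S.X).inv := by
  rw [Functor.map_comp, Category.assoc, map_stableShiftIso_inv]
  have h : (resolution S.Z).homotopyMap (resolution (cosyzygy S.X).obj) S.w.hom ≫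
      (suspensionHomotopyIso S.X).inv = (resolution S.Z).homotopyMap (suspensionResolution S.X)
        S.w.hom ≫ (suspensionResolutionIso S.X).inv := by
    simp only [suspensionHomotopyIso, Iso.trans_inv, Resolution.homotopyIso_inv, Iso.refl_inv,
      ← Category.assoc, ← Resolution.homotopyMap_comp, Category.comp_id]
  exact h

lemma StandardTriangle.triangle_distinguished (S : StandardTriangle C) :
    S.triangle ∈ distTriang (StableGP C) := by
  have h := homotopyMap_distinguished S
  rw [← map_connecting] at h
  exact h

lemma gproj_pushout {X Y : GP C} (u : X ⟶ Y) : GProj C (pushout u.hom (cosyzygy X).ι) := by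
  obtain ⟨φ, hφ⟩ := (resolution X).exists_covers (resolution Y) u.hom
  exact (hφ.coneResolution (isPushout_resolution_i (IsPushout.of_hasPushout _ _))).gproj

/-- The standard triangle that starts with `u`. -/
def standardTriangle {X Y : GP C} (u : X ⟶ Y) : StandardTriangle C where
  X := X
  Y := Y
  Z := ⟨pushout u.hom (cosyzygy X).ι, gproj_pushout u⟩
  u := u
  v := ObjectProperty.homMk (pushout.inl _ _)
  k := pushout.inr _ _
  w := ObjectProperty.homMk (pushout.desc 0 (cosyzygy X).π (by simp [(cosyzygy X).zero]))
  isPushout := IsPushout.of_hasPushout _ _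
  v_w := by
    ext
    exact pushout.inl_desc _ _ _
  k_w := pushout.inr_desc _ _ _

variable (C) in
/-- The triangulated structure of the stable category of Gorenstein projective objects. -/
@[reducible]
def stableTriangulation : StableTriangulation C where
  shift := stableShift C
  shift_additive := stableShift_additive C
  pretriangulated := stablePretriangulated C
  triangulated := stable_isTriangulated C
  shiftIso := stableShiftIso C
  distinguished_iff T := by
    constructor
    · intro hT
      obtain ⟨u, hu⟩ := (toStable C).map_surjective (X := T.obj₁.as) (Y := T.obj₂.as) T.mor₁
      refine ⟨standardTriangle u, ⟨isoTriangleOfIso₁₂ T _ hT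
        (standardTriangle u).triangle_distinguished (Iso.refl _) (Iso.refl _) ?_⟩⟩
      exact (Category.comp_id _).trans (hu.symm.trans (Category.id_comp _).symm)
    · rintro ⟨S, ⟨e⟩⟩
      exact isomorphic_distinguished _ S.triangle_distinguished _ e

end StandardTriangles

section ShortExact

variable {C : Type u} [Category.{v} C] [Abelian C]

lemma exists_lift_of_gproj {Z : C} (hZ : GProj C Z) {S : ShortComplex C} (hS : S.ShortExact)
    (hP : Projective S.X₁) (e : Z ⟶ S.X₃) : ∃ s : Z ⟶ S.X₂, s ≫ S.g = e := by
  obtain ⟨r⟩ := Resolution.nonempty_of_gproj hZ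
  have := hS.epi_g
  have := hS.mono_f
  have := r.complete.projective (-1)
  obtain ⟨a, ha⟩ : ∃ a, a ≫ S.g = r.p ≫ e := ⟨_, Projective.factorThru_comp (r.p ≫ e) S.g⟩
  obtain ⟨b, hb⟩ : ∃ b, b ≫ S.f = r.K.d (-2) (-1) ≫ a :=
    ⟨hS.exact.lift _ (by rw [Category.assoc, ha, Resolution.d_p_assoc]), hS.exact.lift_f _ _⟩
  obtain ⟨c, hc⟩ := r.complete.homExact _ hP (-3) (-2) (-1) (by lia) (by lia) b (by
    rw [← cancel_mono S.f, Category.assoc, hb]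
    simp)
  obtain ⟨s, hs⟩ := r.exists_desc (a - c ≫ S.f) (by
    rw [Preadditive.comp_sub, reassoc_of% hc, hb, sub_self])
  refine ⟨s, ?_⟩
  rw [← cancel_epi r.p, reassoc_of% hs, Preadditive.sub_comp, ha, Category.assoc, S.zero,
    comp_zero, sub_zero]

lemma shortExact_of_isPushout {X Y Z P W : C} {f : X ⟶ Y} {g : Y ⟶ Z} {zero : f ≫ g = 0}
    (hS : (ShortComplex.mk f g zero).ShortExact) {a : X ⟶ P} {v : Y ⟶ W} {k : P ⟶ W}
    (h : IsPushout f a v k) {q : W ⟶ Z} (hv : v ≫ q = g) (hk : k ≫ q = 0) :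
    (ShortComplex.mk k q hk).ShortExact := by
  have : Mono f := hS.mono_f
  have : Epi g := hS.epi_g
  have : Mono k := Abelian.mono_inr_of_isColimit _ _ h.isColimit
  have : Epi q := epi_of_epi_fac hv
  refine ShortComplex.ShortExact.mk (ShortComplex.exact_of_g_is_cokernel _
    (CokernelCofork.IsColimit.ofπ' _ _ fun {T} m hm => ?_))
  have hm' : k ≫ m = 0 := hm
  refine ⟨hS.exact.desc (v ≫ m) (by rw [h.w_assoc, hm', comp_zero]), h.hom_ext ?_ ?_⟩
  · rw [reassoc_of% hv]
    exact hS.exact.g_desc _ _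
  · rw [reassoc_of% hk, zero_comp]
    exact hm'.symm

lemma isIso_toStable_map_of_shortExact {P : C} (hP : Projective P) {W Z : GP C} (q : W ⟶ Z)
    {k : P ⟶ W.obj} {zero : k ≫ q.hom = 0} (hS : (ShortComplex.mk k q.hom zero).ShortExact) :
    IsIso ((toStable C).map q) := by
  have := hS.mono_f
  obtain ⟨s, hs⟩ := exists_lift_of_gproj Z.property hS hP (𝟙 _)
  change s ≫ q.hom = 𝟙 _ at hs
  obtain ⟨t, ht⟩ : ∃ t, t ≫ k = 𝟙 _ - q.hom ≫ s :=
    ⟨hS.exact.lift _ (by simp [hs]), hS.exact.lift_f _ _⟩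
  refine ⟨(toStable C).map (ObjectProperty.homMk s), ?_, ?_⟩
  · rw [← Functor.map_comp, ← (toStable C).map_id]
    exact (CategoryTheory.Quotient.sound _ ⟨_, t, k, hP, ht.symm⟩).symm
  · rw [← Functor.map_comp, ← (toStable C).map_id]
    congr 1
    ext
    exact hs

attribute [local instance] stableShift stableShift_additive stablePretriangulated

lemma exists_distinguished_of_shortExact {X Y Z : GP C} (f : X ⟶ Y) (g : Y ⟶ Z)
    (zero : f.hom ≫ g.hom = 0) (hS : (ShortComplex.mk f.hom g.hom zero).ShortExact) :
    ∃ h : (toStable C).obj Z ⟶ ((toStable C).obj X)⟦(1 : ℤ)⟧,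
      Triangle.mk ((toStable C).map f) ((toStable C).map g) h ∈ distTriang (StableGP C) := by
  let S := standardTriangle f
  let q : S.Z ⟶ Z :=
    ObjectProperty.homMk (S.isPushout.desc g.hom 0 (zero.trans comp_zero.symm))
  have hv : S.v.hom ≫ q.hom = g.hom := S.isPushout.inl_desc _ _ _
  have hk : S.k ≫ q.hom = 0 := S.isPushout.inr_desc _ _ _
  have : IsIso ((toStable C).map q) := isIso_toStable_map_of_shortExact (cosyzygy X).projective q
    (shortExact_of_isPushout hS S.isPushout hv hk)
  have hg : (toStable C).map g = (toStable C).map S.v ≫ (toStable C).map q := by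
    rw [← Functor.map_comp]
    congr 1
    ext
    exact hv.symm
  rw [hg]
  exact ⟨_, distinguished_of_iso₃ S.triangle_distinguished (asIso ((toStable C).map q)).symm⟩

end ShortExact

section InducedFunctors

attribute [local instance] stableShift stableShift_additive stablePretriangulated
  stable_isTriangulated

variable {C : Type u₁} [Category.{v₁} C] [Abelian C] {D : Type u₂} [Category.{v₂} D] [Abelian D]

/-- The functor induced on Gorenstein projective objects. -/
abbrev gpMap (L : C ⥤ D) (hL : PreservesGP L) : GP C ⥤ GP D :=
  (GProj D).lift ((GProj C).ι ⋙ L) fun X => hL.gproj _ X.property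

/-- The functor `L` preserves projective objects and complete projective resolutions. -/
structure PreservesCompleteResolutions (L : C ⥤ D) [L.Additive] : Prop where
  projective : ∀ P : C, Projective P → Projective (L.obj P)
  complete : ∀ K : CochainComplex C ℤ, IsCompleteResolution K →
    IsCompleteResolution ((L.mapHomologicalComplex (ComplexShape.up ℤ)).obj K)

namespace PreservesCompleteResolutions

variable {L : C ⥤ D} [L.Additive] [PreservesFiniteColimits L]

/-- The image of a resolution under a functor that preserves complete resolutions. -/
def mapResolution (hL : PreservesCompleteResolutions L) {X : C} (r : Resolution X) :
    Resolution (L.obj X) where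
  K := (L.mapHomologicalComplex (ComplexShape.up ℤ)).obj r.K
  complete := hL.complete _ r.complete
  p := L.map r.p
  epi_p := L.map_epi r.p
  d_p := (L.map_comp _ _).symm.trans ((congrArg L.map r.d_p).trans (L.map_zero _ _))
  exists_desc g hg :=
    let g' := CokernelCofork.IsColimit.desc' (CokernelCofork.mapIsColimit _ r.isColimit L) g hg
    ⟨g'.1, g'.2⟩

lemma mapResolution_i (hL : PreservesCompleteResolutions L) {X : C} (r : Resolution X) :
    (hL.mapResolution r).i = L.map r.i :=
  Resolution.i_eq _ ((L.map_comp _ _).symm.trans (congrArg L.map r.p_i))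

lemma mono_map_i (hL : PreservesCompleteResolutions L) {X : C} (r : Resolution X) :
    Mono (L.map r.i) := by
  rw [← hL.mapResolution_i r]
  exact inferInstanceAs (Mono (hL.mapResolution r).i)

lemma preservesGP (hL : PreservesCompleteResolutions L) : PreservesGP L where
  gproj X hX := by
    obtain ⟨r⟩ := Resolution.nonempty_of_gproj hX
    exact (hL.mapResolution r).gproj
  projective := hL.projective

lemma mapHomotopyCategory_map_homotopyMap (hL : PreservesCompleteResolutions L) {X Y : C}
    (r : Resolution X) (s : Resolution Y) (f : X ⟶ Y) :
    (L.mapHomotopyCategory (ComplexShape.up ℤ)).map (r.homotopyMap s f) =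
      (hL.mapResolution r).homotopyMap (hL.mapResolution s) (L.map f) := by
  obtain ⟨φ, hφ⟩ := r.exists_covers s f
  have h : Resolution.Covers (hL.mapResolution r) (hL.mapResolution s) (L.map f)
      ((L.mapHomologicalComplex (ComplexShape.up ℤ)).map φ) :=
    (L.map_comp _ _).symm.trans ((congrArg L.map hφ).trans (L.map_comp _ _))
  rw [h.homotopyMap_eq, hφ.homotopyMap_eq]
  rfl

/-- The embeddings into the homotopy categories commute with the functors induced by `L`. -/
def stableMapToHomotopyIso (hL : PreservesCompleteResolutions L) :
    stableMap L hL.preservesGP ⋙ toHomotopy D ≅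
      toHomotopy C ⋙ L.mapHomotopyCategory (ComplexShape.up ℤ) :=
  NatIso.ofComponents (fun X =>
    (resolution ((gpMap L hL.preservesGP).obj X.as)).homotopyIso
      (hL.mapResolution (resolution X.as)) (Iso.refl _)) (by
    intro X Y f
    obtain ⟨f, rfl⟩ := (toStable C).map_surjective f
    let r (Z : GP C) := resolution ((gpMap L hL.preservesGP).obj Z)
    let r' (Z : GP C) := hL.mapResolution (resolution Z)
    calc (r X.as).homotopyMap (r Y.as) (L.map f.hom) ≫ (r Y.as).homotopyMap (r' Y.as) (𝟙 _)
      _ = (r X.as).homotopyMap (r' X.as) (𝟙 _) ≫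
            (r' X.as).homotopyMap (r' Y.as) (L.map f.hom) := by
          rw [← Resolution.homotopyMap_comp, ← Resolution.homotopyMap_comp]
          exact congrArg _ ((Category.comp_id _).trans (Category.id_comp _).symm)
      _ = _ := congrArg (_ ≫ ·) (hL.mapHomotopyCategory_map_homotopyMap _ _ f.hom).symm)

/-- The functor induced on stable categories commutes with the shifts. -/
@[reducible]
def stableMapCommShift (hL : PreservesCompleteResolutions L) :
    (stableMap L hL.preservesGP).CommShift ℤ :=
  Functor.CommShift.ofComp hL.stableMapToHomotopyIso ℤ

lemma stableMap_isTriangulated (hL : PreservesCompleteResolutions L) :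
    letI := hL.stableMapCommShift
    (stableMap L hL.preservesGP).IsTriangulated := by
  let := hL.stableMapCommShift
  have := Functor.CommShift.ofComp_compatibility hL.stableMapToHomotopyIso ℤ
  rw [Functor.isTriangulated_iff_comp_right hL.stableMapToHomotopyIso]
  infer_instance

end PreservesCompleteResolutions

section Adjunction

variable {L : C ⥤ D} {R : D ⥤ C} (adj : L ⊣ R) (hL : PreservesGP L) (hR : PreservesGP R)

/-- The adjunction induced on Gorenstein projective objects. -/
def gpAdjunction : gpMap L hL ⊣ gpMap R hR where
  unit.app X := ObjectProperty.homMk (adj.unit.app X.obj)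
  unit.naturality _ _ f := by
    ext
    exact adj.unit.naturality f.hom
  counit.app X := ObjectProperty.homMk (adj.counit.app X.obj)
  counit.naturality _ _ f := by
    ext
    exact adj.counit.naturality f.hom
  left_triangle_components X := by
    ext
    exact adj.left_triangle_components X.obj
  right_triangle_components X := by
    ext
    exact adj.right_triangle_components X.obj

variable [L.Additive] [R.Additive]

/-- The adjunction induced on stable categories. -/
def stableAdjunction : stableMap L hL ⊣ stableMap R hR where
  unit.app X := (toStable C).map ((gpAdjunction adj hL hR).unit.app X.as)
  unit.naturality X Y f := by
    obtain ⟨f, rfl⟩ := (toStable C).map_surjective f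
    exact (toStable C).congr_map ((gpAdjunction adj hL hR).unit.naturality f)
  counit.app X := (toStable D).map ((gpAdjunction adj hL hR).counit.app X.as)
  counit.naturality X Y f := by
    obtain ⟨f, rfl⟩ := (toStable D).map_surjective f
    exact (toStable D).congr_map ((gpAdjunction adj hL hR).counit.naturality f)
  left_triangle_components X :=
    (toStable D).congr_map ((gpAdjunction adj hL hR).left_triangle_components X.as)
  right_triangle_components X :=
    (toStable C).congr_map ((gpAdjunction adj hL hR).right_triangle_components X.as)

instance [IsIso adj.unit] : IsIso (stableAdjunction adj hL hR).unit := by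
  have (X : GP C) : IsIso ((gpAdjunction adj hL hR).unit.app X) :=
    have : IsIso ((GProj C).ι.map ((gpAdjunction adj hL hR).unit.app X)) :=
      inferInstanceAs (IsIso (adj.unit.app X.obj))
    isIso_of_reflects_iso _ (GProj C).ι
  have (X : StableGP C) : IsIso ((stableAdjunction adj hL hR).unit.app X) :=
    inferInstanceAs (IsIso ((toStable C).map ((gpAdjunction adj hL hR).unit.app X.as)))
  exact NatIso.isIso_of_isIso_app _

instance [IsIso adj.counit] : IsIso (stableAdjunction adj hL hR).counit := by
  have (X : GP D) : IsIso ((gpAdjunction adj hL hR).counit.app X) :=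
    have : IsIso ((GProj D).ι.map ((gpAdjunction adj hL hR).counit.app X)) :=
      inferInstanceAs (IsIso (adj.counit.app X.obj))
    isIso_of_reflects_iso _ (GProj D).ι
  have (X : StableGP D) : IsIso ((stableAdjunction adj hL hR).counit.app X) :=
    inferInstanceAs (IsIso ((toStable D).map ((gpAdjunction adj hL hR).counit.app X.as)))
  exact NatIso.isIso_of_isIso_app _

end Adjunction

end InducedFunctors

section CommaCategory

variable {A : Type u₁} [Category.{v₁} A] {B : Type u₂} [Category.{v₂} B] {F : A ⥤ B}

/-- The structure morphism `φ : F Y ⟶ X` of an object `(Y, X)` of the left comma category, with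
the identity functor of `B` removed from its target. -/
def structureMap (M : LeftComma F) : F.obj M.left ⟶ M.right := M.hom

lemma structureMap_naturality {M N : LeftComma F} (f : M ⟶ N) :
    F.map f.left ≫ structureMap N = structureMap M ≫ f.right := f.w

lemma comma_epi_of_epi {M N : LeftComma F} (f : M ⟶ N) [Epi f.left] [Epi f.right] : Epi f where
  left_cancellation g h w := by
    ext
    · exact (cancel_epi f.left).1 (congrArg CommaMorphism.left w)
    · exact (cancel_epi f.right).1 (congrArg CommaMorphism.right w)

lemma comma_mono_of_mono {M N : LeftComma F} (f : M ⟶ N) [Mono f.left] [Mono f.right] :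
    Mono f where
  right_cancellation g h w := by
    ext
    · exact (cancel_mono f.left).1 (congrArg CommaMorphism.left w)
    · exact (cancel_mono f.right).1 (congrArg CommaMorphism.right w)

variable (F) in
/-- The functor `(Y, X, φ) ↦ X`. -/
abbrev rightFunctor : LeftComma F ⥤ B := Comma.snd F (𝟭 B)

section Adjunctions

variable (F) in
/-- The functor `Y ↦ (Y, F Y)` is left adjoint to `(Y, X) ↦ Y`. -/
def freeAdjunction : freeFunctor F ⊣ leftFunctor F :=
  Adjunction.mkOfHomEquiv
    { homEquiv Y M :=
        { toFun h := h.left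
          invFun a :=
            { left := a
              right := F.map a ≫ structureMap M
              w := (Category.id_comp _).symm }
          left_inv h := by
            ext
            · rfl
            · exact (structureMap_naturality h).trans (Category.id_comp _)
          right_inv _ := rfl }
      homEquiv_naturality_left_symm f g := by
        ext
        · rfl
        · exact (congrArg (· ≫ structureMap _) (F.map_comp f g)).trans (Category.assoc _ _ _)
      homEquiv_naturality_right _ _ := rfl }

lemma freeAdjunction_counit_app_right (M : LeftComma F) :
    ((freeAdjunction F).counit.app M).right = structureMap M :=
  (congrArg (· ≫ structureMap M) (F.map_id M.left)).trans (Category.id_comp _)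

instance : IsIso (freeAdjunction F).unit := by
  have (Y : A) : IsIso ((freeAdjunction F).unit.app Y) := inferInstanceAs (IsIso (𝟙 Y))
  exact NatIso.isIso_of_isIso_app _

variable [Abelian B]

variable (F) in
/-- The functor `Y ↦ (Y, 0)`. -/
def zeroRight : A ⥤ LeftComma F where
  obj Y := { left := Y, right := 0, hom := 0 }
  map f := { left := f, right := 0, w := by simp }
  map_id Y := by
    ext
    rfl

lemma isZero_zeroRight_right (Y : A) : IsZero ((zeroRight F).obj Y).right := isZero_zero B

lemma hom_zeroRight_ext {M : LeftComma F} {Y : A} {f g : M ⟶ (zeroRight F).obj Y}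
    (h : f.left = g.left) : f = g :=
  CommaMorphism.ext h ((isZero_zeroRight_right Y).eq_of_tgt f.right g.right)

/-- The morphism to `(Y, 0)` given by a morphism to `Y`. -/
def toZeroRight {M : LeftComma F} {Y : A} (f : M.left ⟶ Y) : M ⟶ (zeroRight F).obj Y where
  left := f
  right := 0
  w := (isZero_zeroRight_right (F := F) Y).eq_of_tgt _ _

variable (F) in
/-- The functor `(Y, X) ↦ Y` is left adjoint to `Y ↦ (Y, 0)`. -/
def leftAdjunction : leftFunctor F ⊣ zeroRight F :=
  Adjunction.mkOfHomEquiv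
    { homEquiv _ _ :=
        { toFun := toZeroRight
          invFun h := h.left
          left_inv _ := rfl
          right_inv _ := hom_zeroRight_ext rfl }
      homEquiv_naturality_left_symm _ _ := rfl
      homEquiv_naturality_right _ _ := hom_zeroRight_ext rfl }

/-- The projection from `X` to the cokernel of `F Y ⟶ X`. -/
def cokerπ (M : LeftComma F) : M.right ⟶ (cokerFunctor F).obj M := cokernel.π M.hom

instance (M : LeftComma F) : Epi (cokerπ M) := inferInstanceAs (Epi (cokernel.π M.hom))

lemma structureMap_cokerπ (M : LeftComma F) : structureMap M ≫ cokerπ M = 0 :=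
  cokernel.condition M.hom

lemma cokerπ_naturality {M N : LeftComma F} (f : M ⟶ N) :
    cokerπ M ≫ (cokerFunctor F).map f = f.right ≫ cokerπ N :=
  cokernel.π_desc _ _ _

/-- The morphism from the cokernel of `F Y ⟶ X` induced by a morphism from `X`. -/
def cokerDesc {M : LeftComma F} {Z : B} (f : M.right ⟶ Z) (hf : structureMap M ≫ f = 0) :
    (cokerFunctor F).obj M ⟶ Z :=
  cokernel.desc M.hom f hf

lemma cokerπ_desc {M : LeftComma F} {Z : B} (f : M.right ⟶ Z) (hf : structureMap M ≫ f = 0) :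
    cokerπ M ≫ cokerDesc f hf = f :=
  cokernel.π_desc M.hom f hf

variable [Abelian A] [F.Additive]

lemma isZero_zeroLeft_left (X : B) : IsZero ((zeroLeft F).obj X).left := isZero_zero A

lemma hom_zeroLeft_ext {M : LeftComma F} {X : B} {f g : M ⟶ (zeroLeft F).obj X}
    (h : f.right = g.right) : f = g :=
  CommaMorphism.ext ((isZero_zeroLeft_left X).eq_of_tgt f.left g.left) h

lemma zeroLeft_hom_ext {X : B} {M : LeftComma F} {f g : (zeroLeft F).obj X ⟶ M}
    (h : f.right = g.right) : f = g :=
  CommaMorphism.ext ((isZero_zeroLeft_left X).eq_of_src f.left g.left) h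

/-- The morphism to `(0, X)` given by a morphism to `X` which vanishes on `F Y`. -/
def toZeroLeft {M : LeftComma F} {X : B} (f : M.right ⟶ X) (hf : structureMap M ≫ f = 0) :
    M ⟶ (zeroLeft F).obj X where
  left := 0
  right := f
  w := comp_zero.trans hf.symm

lemma structureMap_toZeroLeft_right {M : LeftComma F} {X : B} (f : M ⟶ (zeroLeft F).obj X) :
    structureMap M ≫ f.right = 0 :=
  (structureMap_naturality f).symm.trans comp_zero

/-- The morphism from `(0, X)` given by a morphism from `X`. -/
def ofZeroLeft {X : B} {M : LeftComma F} (f : X ⟶ M.right) : (zeroLeft F).obj X ⟶ M where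
  left := 0
  right := f
  w := (F.map_isZero (isZero_zeroLeft_left X)).eq_of_src _ _

variable (F) in
/-- The functor `(Y, X) ↦ Coker φ` is left adjoint to `X ↦ (0, X)`. -/
def cokerAdjunction : cokerFunctor F ⊣ zeroLeft F :=
  Adjunction.mkOfHomEquiv
    { homEquiv M X :=
        { toFun g := toZeroLeft (cokerπ M ≫ g) (by
            rw [← Category.assoc, structureMap_cokerπ, zero_comp])
          invFun h := cokerDesc (M := M) (Z := X) h.right (structureMap_toZeroLeft_right h)
          left_inv g := by
            rw [← cancel_epi (cokerπ M)]
            exact cokerπ_desc _ _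
          right_inv _ := hom_zeroLeft_ext (cokerπ_desc _ _) }
      homEquiv_naturality_left_symm {M M' X} f g := by
        rw [← cancel_epi (cokerπ M)]
        change cokerπ M ≫ cokerDesc (f.right ≫ g.right) _ =
          cokerπ M ≫ (cokerFunctor F).map f ≫ cokerDesc g.right _
        rw [cokerπ_desc, reassoc_of% cokerπ_naturality f, cokerπ_desc]
      homEquiv_naturality_right _ _ := hom_zeroLeft_ext (Category.assoc _ _ _).symm }

lemma cokerAdjunction_unit_app_right (M : LeftComma F) :
    ((cokerAdjunction F).unit.app M).right = cokerπ M :=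
  Category.comp_id _

instance : (zeroLeft F).Full where
  map_surjective f := ⟨f.right, zeroLeft_hom_ext rfl⟩

instance : (zeroLeft F).Faithful where
  map_injective h := congrArg CommaMorphism.right h

variable (F) in
/-- The functor `X ↦ (0, X)` is left adjoint to `(Y, X) ↦ X`. -/
def zeroLeftAdjunction : zeroLeft F ⊣ rightFunctor F :=
  Adjunction.mkOfHomEquiv
    { homEquiv _ _ :=
        { toFun h := h.right
          invFun := ofZeroLeft
          left_inv _ := zeroLeft_hom_ext rfl
          right_inv _ := rfl }
      homEquiv_naturality_left_symm _ _ := zeroLeft_hom_ext rfl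
      homEquiv_naturality_right _ _ := rfl }

end Adjunctions

end CommaCategory

section HomExactness

variable {C : Type u₁} [Category.{v₁} C] [Abelian C]

lemma acyclic_X₃_of_shortExact {S : ShortComplex (CochainComplex C ℤ)} (hS : S.ShortExact)
    (h₁ : S.X₁.Acyclic) (h₂ : S.X₂.Acyclic) : S.X₃.Acyclic := fun n =>
  (S.X₃.exactAt_iff_isZero_homology n).2 <| (hS.homology_exact₃ n (n + 1) rfl).isZero_X₂
    ((h₂ n).isZero_homology.eq_of_src _ _) ((h₁ (n + 1)).isZero_homology.eq_of_tgt _ _)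

section ShortExact

variable {K : CochainComplex C ℤ} (hK : ∀ n, Projective (K.X n)) {S : ShortComplex C}
  (hS : S.ShortExact)

include hS hK

lemma HomExact.X₃_of_shortExact (h₁ : HomExact K S.X₁) (h₂ : HomExact K S.X₂) :
    HomExact K S.X₃ := by
  intro i j k hij hjk f hf
  have := hS.mono_f
  have := hS.epi_g
  have := hK j
  obtain ⟨f', hf'⟩ := Projective.factors f S.g
  obtain ⟨a, ha⟩ := hS.exact.lift' (K.d i j ≫ f') (by rw [Category.assoc, hf', hf])
  obtain ⟨b, hb⟩ := h₁ (i - 1) i j (by lia) hij a (by simp [← cancel_mono S.f, ha])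
  obtain ⟨g, hg⟩ := h₂ i j k hij hjk (f' - b ≫ S.f) (by simp [← ha, ← hb])
  exact ⟨g ≫ S.g, by rw [← Category.assoc, hg]; simp [hf']⟩

lemma HomExact.X₂_of_shortExact (h₁ : HomExact K S.X₁) (h₃ : HomExact K S.X₃) :
    HomExact K S.X₂ := by
  intro i j k hij hjk f hf
  have := hS.mono_f
  have := hS.epi_g
  have := hK k
  obtain ⟨c, hc⟩ := h₃ i j k hij hjk (f ≫ S.g) (by rw [reassoc_of% hf, zero_comp])
  obtain ⟨c', hc'⟩ := Projective.factors c S.g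
  obtain ⟨a, ha⟩ := hS.exact.lift' (f - K.d j k ≫ c') (by simp [hc', hc])
  obtain ⟨b, hb⟩ := h₁ i j k hij hjk a (by simp [← cancel_mono S.f, ha, hf])
  exact ⟨b ≫ S.f + c', by simp [reassoc_of% hb, ha]⟩

end ShortExact

variable {D : Type u₂} [Category.{v₂} D] [Abelian D]

lemma homExact_map_iff {L : C ⥤ D} {R : D ⥤ C} [L.Additive] (adj : L ⊣ R)
    {K : CochainComplex C ℤ} {Z : D} :
    HomExact ((L.mapHomologicalComplex (ComplexShape.up ℤ)).obj K) Z ↔ HomExact K (R.obj Z) := by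
  have := adj.right_adjoint_additive
  have comp_eq_zero {i j : ℤ} (f : L.obj (K.X j) ⟶ Z) :
      K.d i j ≫ adj.homEquiv _ _ f = 0 ↔ L.map (K.d i j) ≫ f = 0 := by
    rw [← adj.homEquiv_naturality_left, ← (adj.homAddEquiv _ _).map_eq_zero_iff]
    rfl
  have comp_eq {j k : ℤ} (f : L.obj (K.X j) ⟶ Z) (g : L.obj (K.X k) ⟶ Z) :
      K.d j k ≫ adj.homEquiv _ _ g = adj.homEquiv _ _ f ↔ L.map (K.d j k) ≫ g = f := by
    rw [← adj.homEquiv_naturality_left, (adj.homEquiv _ _).apply_eq_iff_eq]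
  constructor
  · intro h i j k hij hjk f hf
    obtain ⟨f, rfl⟩ := (adj.homEquiv _ _).surjective f
    obtain ⟨g, hg⟩ := h i j k hij hjk f ((comp_eq_zero f).1 hf)
    exact ⟨adj.homEquiv _ _ g, (comp_eq f g).2 hg⟩
  · intro h i j k hij hjk f hf
    obtain ⟨g, hg⟩ := h i j k hij hjk (adj.homEquiv _ _ f) ((comp_eq_zero f).2 hf)
    obtain ⟨g, rfl⟩ := (adj.homEquiv _ _).surjective g
    exact ⟨g, (comp_eq f g).1 hg⟩

lemma acyclic_map (L : C ⥤ D) [L.Additive] [PreservesFiniteLimits L] [PreservesFiniteColimits L]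
    {K : CochainComplex C ℤ} (hK : K.Acyclic) :
    ((L.mapHomologicalComplex (ComplexShape.up ℤ)).obj K).Acyclic :=
  fun n => (hK n).map L

end HomExactness

section CommaExactness

variable {A : Type u₁} [Category.{v₁} A] {B : Type u₂} [Category.{v₂} B] [Abelian B]
  {F : A ⥤ B}

lemma shortExact_structureMap_cokerπ (M : LeftComma F) [Mono (structureMap M)] :
    (ShortComplex.mk _ _ (structureMap_cokerπ M)).ShortExact where
  exact := ShortComplex.exact_cokernel M.hom
  mono_f := ‹_›
  epi_g := inferInstanceAs (Epi (cokerπ M))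

instance : (zeroRight F).PreservesEpimorphisms where
  preserves {Y Y'} f _ := by
    have : Epi ((zeroRight F).map f).left := inferInstanceAs (Epi f)
    have : Epi ((zeroRight F).map f).right :=
      ⟨fun g h _ => (isZero_zeroRight_right Y').eq_of_src g h⟩
    exact comma_epi_of_epi _

lemma projective_left {M : LeftComma F} (hM : Projective M) : Projective M.left :=
  (leftAdjunction F).map_projective M hM

lemma mono_structureMap_of_projective {M : LeftComma F} (hM : Projective M) :
    Mono (structureMap M) := by
  let T : LeftComma F := { left := M.left, right := F.obj M.left ⊞ M.right, hom := biprod.inl }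
  let e : T ⟶ M :=
    { left := 𝟙 M.left
      right := biprod.desc (structureMap M) (𝟙 M.right)
      w := by simp [T, structureMap] }
  have : Epi e.left := inferInstanceAs (Epi (𝟙 M.left))
  have : Epi e.right := epi_of_epi_fac (biprod.inr_desc (structureMap M) (𝟙 M.right))
  have := comma_epi_of_epi e
  let s := Projective.factorThru (𝟙 M) e
  have hs : s ≫ e = 𝟙 M := Projective.factorThru_comp _ _
  have hl : s.left = 𝟙 M.left := (Category.comp_id _).symm.trans (congrArg CommaMorphism.left hs)
  have : structureMap M ≫ s.right = biprod.inl := by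
    rw [← structureMap_naturality, hl]
    exact (congrArg (· ≫ biprod.inl) (F.map_id M.left)).trans (Category.id_comp _)
  exact mono_of_mono_fac this

variable [Abelian A] [F.Additive]

lemma isZero_comma {M : LeftComma F} (h₁ : IsZero M.left) (h₂ : IsZero M.right) : IsZero M := by
  rw [IsZero.iff_id_eq_zero]
  exact CommaMorphism.ext (h₁.eq_of_src _ _) (h₂.eq_of_src _ _)

instance : (zeroLeft F).PreservesEpimorphisms :=
  Functor.preservesEpimorphisms_of_adjunction (zeroLeftAdjunction F)

lemma projective_coker {M : LeftComma F} (hM : Projective M) :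
    Projective ((cokerFunctor F).obj M) :=
  (cokerAdjunction F).map_projective M hM

lemma free_counit_comp_coker_unit (M : LeftComma F) :
    (freeAdjunction F).counit.app M ≫ (cokerAdjunction F).unit.app M = 0 :=
  hom_zeroLeft_ext <| (congrArg₂ (· ≫ ·) (freeAdjunction_counit_app_right M)
    (cokerAdjunction_unit_app_right M)).trans (structureMap_cokerπ M)

lemma zeroLeft_counit_comp_left_unit (M : LeftComma F) :
    (zeroLeftAdjunction F).counit.app M ≫ (leftAdjunction F).unit.app M = 0 :=
  hom_zeroRight_ext ((isZero_zeroLeft_left M.right).eq_of_src _ _)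

variable [PreservesFiniteColimits F]

instance : PreservesFiniteLimits (leftFunctor F) where
  preservesFiniteLimits _ _ _ := inferInstance

instance : PreservesFiniteLimits (rightFunctor F) where
  preservesFiniteLimits _ _ _ := inferInstance

instance : PreservesFiniteColimits (leftFunctor F) where
  preservesFiniteColimits _ _ _ := inferInstance

instance : PreservesFiniteColimits (rightFunctor F) where
  preservesFiniteColimits _ _ _ := inferInstance

lemma projective_zeroLeft {X : B} (hX : Projective X) : Projective ((zeroLeft F).obj X) :=
  (zeroLeftAdjunction F).map_projective X hX

lemma projective_free {Y : A} (hY : Projective Y) : Projective ((freeFunctor F).obj Y) :=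
  (freeAdjunction F).map_projective Y hY

lemma comma_exact {S : ShortComplex (LeftComma F)} (h₁ : (S.map (leftFunctor F)).Exact)
    (h₂ : (S.map (rightFunctor F)).Exact) : S.Exact := by
  rw [ShortComplex.exact_iff_isZero_homology] at h₁ h₂ ⊢
  exact isZero_comma (h₁.of_iso (S.mapHomologyIso (leftFunctor F)).symm)
    (h₂.of_iso (S.mapHomologyIso (rightFunctor F)).symm)

lemma comma_shortExact {S : ShortComplex (LeftComma F)} (h₁ : (S.map (leftFunctor F)).ShortExact)
    (h₂ : (S.map (rightFunctor F)).ShortExact) : S.ShortExact where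
  exact := comma_exact h₁.exact h₂.exact
  mono_f :=
    have : Mono S.f.left := h₁.mono_f
    have : Mono S.f.right := h₂.mono_f
    comma_mono_of_mono S.f
  epi_g :=
    have : Epi S.g.left := h₁.epi_g
    have : Epi S.g.right := h₂.epi_g
    comma_epi_of_epi S.g

lemma comma_acyclic {K : CochainComplex (LeftComma F) ℤ}
    (h₁ : (((leftFunctor F).mapHomologicalComplex (ComplexShape.up ℤ)).obj K).Acyclic)
    (h₂ : (((rightFunctor F).mapHomologicalComplex (ComplexShape.up ℤ)).obj K).Acyclic) :
    K.Acyclic :=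
  fun n => comma_exact (h₁ n) (h₂ n)

lemma shortExact_free_zeroLeft (M : LeftComma F) [Mono (structureMap M)] :
    (ShortComplex.mk _ _ (free_counit_comp_coker_unit M)).ShortExact := by
  refine comma_shortExact (ShortComplex.Splitting.ofIsIsoOfIsZero _ ?_ ?_).shortExact ?_
  · exact inferInstanceAs (IsIso (𝟙 M.left))
  · exact isZero_zeroLeft_left (F := F) ((cokerFunctor F).obj M)
  · have h {f : F.obj M.left ⟶ M.right} {g : M.right ⟶ (cokerFunctor F).obj M}
        (hf : f = structureMap M) (hg : g = cokerπ M) (zero : f ≫ g = 0) :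
        (ShortComplex.mk f g zero).ShortExact := by
      subst hf hg
      exact shortExact_structureMap_cokerπ M
    exact h (freeAdjunction_counit_app_right M) (cokerAdjunction_unit_app_right M) _

lemma shortExact_zeroLeft_zeroRight (M : LeftComma F) :
    (ShortComplex.mk _ _ (zeroLeft_counit_comp_left_unit M)).ShortExact := by
  refine comma_shortExact (ShortComplex.Splitting.ofIsZeroOfIsIso _ ?_ ?_).shortExact
    (ShortComplex.Splitting.ofIsIsoOfIsZero _ ?_ ?_).shortExact
  · exact isZero_zeroLeft_left (F := F) M.right
  · exact inferInstanceAs (IsIso (𝟙 M.left))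
  · exact inferInstanceAs (IsIso (𝟙 M.right))
  · exact isZero_zeroRight_right (F := F) M.left

end CommaExactness

section PerfectFunctors

variable {A : Type u₁} [Category.{v₁} A] [Abelian A] {B : Type u₂} [Category.{v₂} B] [Abelian B]
  {F : A ⥤ B} [F.Additive]

lemma IsPerfect.homExact_right (hF : IsPerfect F) {K : CochainComplex B ℤ}
    (hK : IsCompleteResolution K) {M : LeftComma F} (hM : Projective M) : HomExact K M.right :=
  have := mono_structureMap_of_projective hM
  HomExact.X₂_of_shortExact hK.projective (shortExact_structureMap_cokerπ M)
    (hF.homExact K hK _ (projective_left hM)) (hK.homExact _ (projective_coker hM))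

instance : PreservesFiniteColimits (cokerFunctor F) where
  preservesFiniteColimits _ _ _ :=
    have := (cokerAdjunction F).leftAdjoint_preservesColimits
    inferInstance

instance : PreservesFiniteColimits (zeroLeft F) where
  preservesFiniteColimits _ _ _ :=
    have := (zeroLeftAdjunction F).leftAdjoint_preservesColimits
    inferInstance

instance : PreservesFiniteColimits (freeFunctor F) where
  preservesFiniteColimits _ _ _ :=
    have := (freeAdjunction F).leftAdjoint_preservesColimits
    inferInstance

variable [PreservesFiniteColimits F]

lemma acyclic_coker {K : CochainComplex (LeftComma F) ℤ} (hm : ∀ n, Mono (structureMap (K.X n)))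
    (hK : K.Acyclic)
    (hfree : (((leftFunctor F ⋙ freeFunctor F).mapHomologicalComplex
      (ComplexShape.up ℤ)).obj K).Acyclic) :
    (((cokerFunctor F).mapHomologicalComplex (ComplexShape.up ℤ)).obj K).Acyclic := by
  let S : ShortComplex (CochainComplex (LeftComma F) ℤ) :=
    { f := (NatTrans.mapHomologicalComplex (freeAdjunction F).counit (ComplexShape.up ℤ)).app K
      g := (NatTrans.mapHomologicalComplex (cokerAdjunction F).unit (ComplexShape.up ℤ)).app K
      zero := by
        ext n : 1
        exact free_counit_comp_coker_unit (K.X n) }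
  have hS : S.ShortExact :=
    HomologicalComplex.shortExact_of_degreewise_shortExact S fun n =>
      shortExact_free_zeroLeft (K.X n)
  exact acyclic_map (rightFunctor F) (acyclic_X₃_of_shortExact hS hfree hK)

namespace IsPerfect

variable (hF : IsPerfect F)

include hF

lemma acyclic_free {K : CochainComplex A ℤ} (hK : ∀ n, Projective (K.X n)) (hK' : K.Acyclic) :
    (((freeFunctor F).mapHomologicalComplex (ComplexShape.up ℤ)).obj K).Acyclic :=
  comma_acyclic hK' (hF.exact K hK hK')

lemma coker_preserves : PreservesCompleteResolutions (cokerFunctor F) where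
  projective _ := projective_coker
  complete _ hK :=
    { projective n := projective_coker (hK.projective n)
      acyclic := acyclic_coker (fun n => mono_structureMap_of_projective (hK.projective n))
        hK.acyclic (hF.acyclic_free (fun n => projective_left (hK.projective n))
          (acyclic_map (leftFunctor F) hK.acyclic))
      homExact _ hP := (homExact_map_iff (cokerAdjunction F)).2
        (hK.homExact _ (projective_zeroLeft hP)) }

lemma zeroLeft_preserves : PreservesCompleteResolutions (zeroLeft F) where
  projective _ := projective_zeroLeft
  complete K hK :=
    { projective n := projective_zeroLeft (hK.projective n)
      acyclic := comma_acyclic (fun n =>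
        ShortComplex.exact_of_isZero_X₂ _ (isZero_zeroLeft_left (F := F) (K.X n))) hK.acyclic
      homExact _ hM := (homExact_map_iff (zeroLeftAdjunction F)).2 (hF.homExact_right hK hM) }

lemma free_preserves : PreservesCompleteResolutions (freeFunctor F) where
  projective _ := projective_free
  complete _ hK :=
    { projective n := projective_free (hK.projective n)
      acyclic := hF.acyclic_free hK.projective hK.acyclic
      homExact _ hM :=
        (homExact_map_iff (freeAdjunction F)).2 (hK.homExact _ (projective_left hM)) }

lemma homExact_zeroRight {K : CochainComplex (LeftComma F) ℤ} (hK : IsCompleteResolution K)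
    {Q : A} (hQ : Projective Q) : HomExact K ((zeroRight F).obj Q) :=
  HomExact.X₃_of_shortExact hK.projective
    (shortExact_zeroLeft_zeroRight ((freeFunctor F).obj Q))
    ((homExact_map_iff (cokerAdjunction F)).1
      (hF.homExact _ (hF.coker_preserves.complete K hK) Q hQ))
    (hK.homExact _ (projective_free hQ))

lemma left_preserves : PreservesCompleteResolutions (leftFunctor F) where
  projective _ := projective_left
  complete _ hK :=
    { projective n := projective_left (hK.projective n)
      acyclic := acyclic_map (leftFunctor F) hK.acyclic
      homExact _ hQ := (homExact_map_iff (leftAdjunction F)).2 (hF.homExact_zeroRight hK hQ) }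

lemma mono_structureMap {M : LeftComma F} (hM : GProj (LeftComma F) M) :
    Mono (structureMap M) := by
  obtain ⟨r⟩ := Resolution.nonempty_of_gproj hM
  have : Mono ((freeFunctor F).map r.i.left) := by
    have h := hF.free_preserves.mono_map_i (hF.left_preserves.mapResolution r)
    rwa [hF.left_preserves.mapResolution_i] at h
  have : Mono (F.map r.i.left) := (rightFunctor F).map_mono ((freeFunctor F).map r.i.left)
  have := mono_structureMap_of_projective (r.complete.projective 0)
  have : Mono (structureMap M ≫ r.i.right) := by
    rw [← structureMap_naturality]
    exact mono_comp _ _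
  exact mono_of_mono _ r.i.right

attribute [local instance] stableShift stableShift_additive stablePretriangulated
  stable_isTriangulated

/-- The adjunction `i^* ⊣ i_*`. -/
abbrev cokerStableAdjunction :
    stableMap (cokerFunctor F) hF.coker_preserves.preservesGP ⊣
      stableMap (zeroLeft F) hF.zeroLeft_preserves.preservesGP :=
  stableAdjunction (cokerAdjunction F) _ _

/-- The adjunction `j_! ⊣ j^*`. -/
abbrev freeStableAdjunction :
    stableMap (freeFunctor F) hF.free_preserves.preservesGP ⊣
      stableMap (leftFunctor F) hF.left_preserves.preservesGP :=
  stableAdjunction (freeAdjunction F) _ _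

lemma exists_distinguished (M : StableGP (LeftComma F)) :
    ∃ h, Triangle.mk (hF.freeStableAdjunction.counit.app M)
      (hF.cokerStableAdjunction.unit.app M) h ∈ distTriang (StableGP (LeftComma F)) :=
  have := hF.mono_structureMap M.as.property
  exists_distinguished_of_shortExact
    ((gpAdjunction (freeAdjunction F) hF.free_preserves.preservesGP
      hF.left_preserves.preservesGP).counit.app M.as)
    ((gpAdjunction (cokerAdjunction F) hF.coker_preserves.preservesGP
      hF.zeroLeft_preserves.preservesGP).unit.app M.as)
    _ (shortExact_free_zeroLeft M.as.obj)

/-- The left recollement of the stable categories induced by a perfect functor. -/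
def leftRecollement : LeftRecollement
    (stableMap (cokerFunctor F) hF.coker_preserves.preservesGP)
    (stableMap (zeroLeft F) hF.zeroLeft_preserves.preservesGP)
    (stableMap (freeFunctor F) hF.free_preserves.preservesGP)
    (stableMap (leftFunctor F) hF.left_preserves.preservesGP) where
  iUp_commShift := hF.coker_preserves.stableMapCommShift
  iUp_exact := hF.coker_preserves.stableMap_isTriangulated
  iLow_commShift := hF.zeroLeft_preserves.stableMapCommShift
  iLow_exact := hF.zeroLeft_preserves.stableMap_isTriangulated
  jShriek_commShift := hF.free_preserves.stableMapCommShift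
  jShriek_exact := hF.free_preserves.stableMap_isTriangulated
  jUp_commShift := hF.left_preserves.stableMapCommShift
  jUp_exact := hF.left_preserves.stableMap_isTriangulated
  adj_i := hF.cokerStableAdjunction
  adj_j := hF.freeStableAdjunction
  iLow_full := hF.cokerStableAdjunction.fullyFaithfulROfIsIsoCounit.full
  iLow_faithful := hF.cokerStableAdjunction.fullyFaithfulROfIsIsoCounit.faithful
  jShriek_full := hF.freeStableAdjunction.fullyFaithfulLOfIsIsoUnit.full
  jShriek_faithful := hF.freeStableAdjunction.fullyFaithfulLOfIsIsoUnit.faithful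
  comp_zero X := by
    let Z : GP A := (gpMap (leftFunctor F) hF.left_preserves.preservesGP).obj
      ((gpMap (zeroLeft F) hF.zeroLeft_preserves.preservesGP).obj X.as)
    have hZ : IsZero Z := by
      rw [IsZero.iff_id_eq_zero]
      ext
      exact (isZero_zeroLeft_left (F := F) X.as.obj).eq_of_src _ _
    exact (toStable A).map_isZero hZ
  triangle := hF.exists_distinguished

end IsPerfect

end PerfectFunctors

end GorensteinComma

end

theorem theorem4p4 {A : Type u₁} [Category.{v₁} A] [Abelian A]
    {B : Type u₂} [Category.{v₂} B] [Abelian B]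
    (F : A ⥤ B) [F.Additive] [PreservesFiniteColimits F] (hF : IsPerfect F) :
    ∃ (_ : StableTriangulation A) (_ : StableTriangulation B)
      (_ : StableTriangulation (LeftComma F))
      (h₁ : PreservesGP (cokerFunctor F)) (h₂ : PreservesGP (zeroLeft F))
      (h₃ : PreservesGP (freeFunctor F)) (h₄ : PreservesGP (leftFunctor F)),
      Nonempty (LeftRecollement
        (stableMap (cokerFunctor F) h₁) (stableMap (zeroLeft F) h₂)
        (stableMap (freeFunctor F) h₃) (stableMap (leftFunctor F) h₄)) :=
  ⟨stableTriangulation A, stableTriangulation B, stableTriangulation (LeftComma F),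
    hF.coker_preserves.preservesGP, hF.zeroLeft_preserves.preservesGP,
    hF.free_preserves.preservesGP, hF.left_preserves.preservesGP, ⟨hF.leftRecollement⟩⟩
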